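/- Let $d \geq 1$, let $\mathcal{A} \subseteq \mathbb{R}^d$ be an action set with $\|a\|_2 \leq 1$ for all $a \in \mathcal{A}$ on which $a \mapsto a^\top \theta$ attains its maximum for every $\theta \in \mathbb{R}^d$, and let $\mathrm{argmax}_{a \in \mathcal{A}}\, a^\top \theta$ denote a fixed measurable choice of a maximizer. Let $\mu_q \in \mathbb{R}^d$, let $\Sigma_q \in \mathbb{R}^{d \times d}$ be positive semi-definite, $\Sigma_0 \in \mathbb{R}^{d \times d}$ positive definite and $\sigma > 0$. In the hierarchical linear bandit with $m$ tasks, $\mu_* \sim \mathcal{N}(\mu_q, \Sigma_q)$ and, given $\mu_*$, the task parameters $\theta_{s,*} \sim \mathcal{N}(\mu_*, \Sigma_0)$, $s \in [m]$, are i.i.d. In each round $t \geq 1$ the agent observes a set of tasks $\mathcal{S}_t \subseteq [m]$, which may depend arbitrarily on the history $H_t$ but on $(\mu_*, (\theta_{s,*})_s)$ only through $H_t$; here $H_t$ consists, for every task $s$, of the history $H_{s,t} = ((A_{s,\ell}, Y_{s,\ell}))_{\ell < t,\, s \in \mathcal{S}_\ell}$ of the actions taken and rewards observed in task $s$ before round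 $t$. The agent runs hierarchical Thompson sampling: it samples $\mu_t$ from the hyper-posterior $\mathbb{P}(\mu_* \in \cdot \mid H_t)$ and, independently for the tasks $s \in \mathcal{S}_t$, samples $\theta_{s,t}$ from $\mathbb{P}(\theta_{s,*} \in \cdot \mid \mu_* = \mu_t, H_{s,t})$; it takes the actions $A_{s,t} = \mathrm{argmax}_{a \in \mathcal{A}}\, a^\top \theta_{s,t}$ and observes independent rewards $Y_{s,t} \sim \mathcal{N}(A_{s,t}^\top \theta_{s,*}, \sigma^2)$. Each task belongs to $\mathcal{S}_t$ for at most $n$ rounds $t$, almost surely. Let $A_{s,*} = \mathrm{argmax}_{a \in \mathcal{A}}\, a^\top \theta_{s,*}$, let $\hat\Sigma_{s,t} = \mathrm{cov}[\theta_{s,*} \mid H_t]$ be the posterior covariance, and put $$\mathcal{BR}(m,n) = \mathbb{E}\Big[\sum_{t \geq 1} \sum_{s \in \mathcal{S}_t} \big(A_{s,*}^\top \theta_{s,*} - A_{s,t}^\top \theta_{s,*}\big)\Big], \qquad \mathcal{V}(m,n) = \mathbb{E}\Big[\sum_{t \geq 1} \sum_{s \in \mathcal{S}_t} A_{s,t}^\top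 \hat\Sigma_{s,t} A_{s,t}\Big].$$ Both sums are integrable, and for any $\delta > 0$, $$\mathcal{BR}(m,n) \leq \sqrt{2 d m n\, \mathcal{V}(m,n) \log(1/\delta)} + \sqrt{2/\pi}\, \sigma_{\max}\, d^{3/2}\, m n \delta,$$ where $\sigma_{\max} = \sqrt{\lambda_1(\Sigma_0) + \lambda_1^2(\Sigma_0) \lambda_1(\Sigma_q) / \lambda_d^2(\Sigma_0)}$, and $\lambda_1$ and $\lambda_d$ are the largest and the smallest eigenvalue. If moreover $\mathcal{A}$ is finite with $|\mathcal{A}| = K$, then also $$\mathcal{BR}(m,n) \leq \sqrt{2 m n\, \mathcal{V}(m,n) \log(1/\delta)} + \sqrt{2/\pi}\, \sigma_{\max}\, K\, m n \delta.$$ (For $\delta > 1$, where $\log(1/\delta) < 0$, the square root of a negative number is read as $0$.) -/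

import Mathlib

open MeasureTheory ProbabilityTheory
open scoped Matrix

noncomputable section

namespace HierBandit

/-- Parameters and actions: vectors of `ℝ^d` with the Euclidean norm. -/
abbrev Vec (d : ℕ) : Type := EuclideanSpace ℝ (Fin d)

/-! ### Eigenvalues -/

/-- `λ₁(M)`, the largest (real) eigenvalue of `M`. -/
def maxEig {d : ℕ} (M : Matrix (Fin d) (Fin d) ℝ) : ℝ := sSup (spectrum ℝ M)

/-- `λ_d(M)`, the smallest (real) eigenvalue of `M`. -/
def minEig {d : ℕ} (M : Matrix (Fin d) (Fin d) ℝ) : ℝ := sInf (spectrum ℝ M)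

/-- `σ_max`, where `σ_max² = λ₁(Σ₀) + λ₁(Σ₀)² λ₁(Σ_q) / λ_d(Σ₀)²`. -/
def sigmaMax {d : ℕ} (S0 Sq : Matrix (Fin d) (Fin d) ℝ) : ℝ :=
  Real.sqrt (maxEig S0 + maxEig S0 ^ 2 * maxEig Sq / minEig S0 ^ 2)

/-! ### The action set -/

/-- `sel` is a (measurable) version of `θ ↦ argmax_{a ∈ 𝒜} aᵀ θ`. -/
structure IsArgmax {d : ℕ} (𝒜 : Set (Vec d)) (sel : Vec d → Vec d) : Prop where
  measurable : Measurable sel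
  mem : ∀ θ, sel θ ∈ 𝒜
  isMaxOn : ∀ θ, IsMaxOn (fun a : Vec d => inner ℝ a θ) 𝒜 (sel θ)

/-! ### Kernels -/

/-- Product of finitely many Markov kernels: independent coordinates, the `i`-th one with law
`κ i a`. -/
def piKernel {ι α : Type*} [Fintype ι] {β : ι → Type*} [MeasurableSpace α]
    [∀ i, MeasurableSpace (β i)] (κ : ∀ i, Kernel α (β i)) [∀ i, IsMarkovKernel (κ i)] :
    Kernel α (∀ i, β i) where
  toFun a := Measure.pi fun i => κ i a
  measurable' := by
    refine Measurable.measure_of_isPiSystem_of_isProbabilityMeasure generateFrom_pi.symm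
      isPiSystem_pi ?_
    rintro s ⟨t, ht, rfl⟩
    simp only [Measure.pi_pi]
    exact Finset.measurable_prod _ fun i _ => (κ i).measurable_coe (ht i (Set.mem_univ i))

instance {ι α : Type*} [Fintype ι] {β : ι → Type*} [MeasurableSpace α]
    [∀ i, MeasurableSpace (β i)] (κ : ∀ i, Kernel α (β i)) [∀ i, IsMarkovKernel (κ i)] :
    IsMarkovKernel (piKernel κ) :=
  ⟨fun a => by change IsProbabilityMeasure (Measure.pi fun i => κ i a); infer_instance⟩

section
open scoped MatrixOrder

/-- The kernel `μ ↦ N(μ, S)` on `ℝ^d`. -/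
def gaussKernel {d : ℕ} (S : Matrix (Fin d) (Fin d) ℝ) : Kernel (Vec d) (Vec d) where
  toFun μ := multivariateGaussian μ S
  measurable' := by
    refine Measure.measurable_of_measurable_coe _ fun s hs => ?_
    simp only [multivariateGaussian]
    have h : Measurable fun p : Vec d × Vec d =>
        p.1 + Matrix.toEuclideanCLM (𝕜 := ℝ) (CFC.sqrt S) p.2 := by fun_prop
    have h2 := measurable_measure_prodMk_left (ν := stdGaussian (Vec d)) (h hs)
    convert h2 using 2 with μ
    rw [Measure.map_apply (by fun_prop) hs]
    rfl

end

instance {d : ℕ} (S : Matrix (Fin d) (Fin d) ℝ) : IsMarkovKernel (gaussKernel S) :=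
  ⟨fun μ => by change IsProbabilityMeasure (multivariateGaussian μ S); infer_instance⟩

/-- The kernel `(θ, a) ↦ N(aᵀ θ, σ²)`: law of the reward of action `a` under parameter `θ`. -/
def rewardKernel (d : ℕ) (σ : ℝ) : Kernel (Vec d × Vec d) ℝ where
  toFun p := gaussianReal (inner ℝ p.2 p.1) (σ ^ 2).toNNReal
  measurable' := by
    have h : Measurable fun p : Vec d × Vec d =>
        ((inner ℝ p.2 p.1 : ℝ), (σ ^ 2).toNNReal) := by fun_prop
    exact measurable_gaussianReal.comp h

instance (d : ℕ) (σ : ℝ) : IsMarkovKernel (rewardKernel d σ) :=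
  ⟨fun p => by
    change IsProbabilityMeasure (gaussianReal (inner ℝ p.2 p.1) (σ ^ 2).toNNReal)
    infer_instance⟩

/-! ### Histories -/

/-- Histories of one task before round `t`. The entry of round `ℓ < t` is `(true, a, y)` if the
agent acted in the task, where `a` is the action and `y` the reward, and `(false, 0, 0)` if not. -/
abbrev TaskHist (d t : ℕ) : Type := Fin t → Bool × Vec d × ℝ

/-- Histories `H_t = (H_{s,t})_s` of all `m` tasks before round `t`. -/
abbrev Hist (d m t : ℕ) : Type := Fin m → TaskHist d t

/-! ### Interaction of the agent with the tasks -/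

/-- The random variables of an interaction with `m` tasks. Rounds are numbered from `0`.
`thetaSample s t` and `reward s t` are relevant only on the event that task `s` is among the tasks
of round `t`; off this event they are not observed and are not used. -/
structure Interaction (Ω : Type*) (d m : ℕ) where
  /-- the hyper-parameter `μ_*` -/
  muStar : Ω → Vec d
  /-- the task parameters `θ_{s,*}` -/
  thetaStar : Fin m → Ω → Vec d
  /-- the set `𝒮_t` of tasks of round `t` -/
  tasks : ℕ → Ω → Finset (Fin m)
  /-- the sampled hyper-parameter `μ_t` -/
  muSample : ℕ → Ω → Vec d
  /-- the sampled task parameters `θ_{s,t}` -/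
  thetaSample : Fin m → ℕ → Ω → Vec d
  /-- the rewards `Y_{s,t}` -/
  reward : Fin m → ℕ → Ω → ℝ

namespace Interaction

variable {Ω : Type*} {d m : ℕ} (X : Interaction Ω d m) (sel : Vec d → Vec d)

/-- The action `A_{s,t} = argmax_a aᵀ θ_{s,t}`. -/
def action (s : Fin m) (t : ℕ) (ω : Ω) : Vec d := sel (X.thetaSample s t ω)

/-- The optimal action `A_{s,*} = argmax_a aᵀ θ_{s,*}`. -/
def optAction (s : Fin m) (ω : Ω) : Vec d := sel (X.thetaStar s ω)

/-- The history `H_{s,t}` of task `s` before round `t`. -/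
def taskHist (s : Fin m) (t : ℕ) (ω : Ω) : TaskHist d t := fun ℓ =>
  if s ∈ X.tasks ℓ ω then (true, X.action sel s ℓ ω, X.reward s ℓ ω) else (false, 0, 0)

/-- The history `H_t` of all tasks before round `t`. -/
def hist (t : ℕ) (ω : Ω) : Hist d m t := fun s => X.taskHist sel s t ω

/-- The environment `(μ_*, (θ_{s,*})_s)`. -/
def env (ω : Ω) : Vec d × (Fin m → Vec d) := (X.muStar ω, fun s => X.thetaStar s ω)

variable [MeasurableSpace Ω] (P : Measure Ω) [IsProbabilityMeasure P]

/-- The hyper-posterior `Q_t = P(μ_* = · | H_t)`. -/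
def hyperPosterior (t : ℕ) : Kernel (Hist d m t) (Vec d) :=
  condDistrib X.muStar (X.hist sel t) P

/-- The conditional posterior `P_{s,t}(· | μ) = P(θ_{s,*} = · | μ_* = μ, H_{s,t})`. -/
def condPosterior (s : Fin m) (t : ℕ) : Kernel (TaskHist d t × Vec d) (Vec d) :=
  condDistrib (X.thetaStar s) (fun ω => (X.taskHist sel s t ω, X.muStar ω)) P

/-- The joint law of the samples `(θ_{s,t})_s` given `(H_t, μ_t)`: independent over the tasks, with
`θ_{s,t} ∼ P_{s,t}(· | μ_t)`. -/
def sampleKernel (t : ℕ) : Kernel (Hist d m t × Vec d) (Fin m → Vec d) :=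
  haveI : ∀ s, IsMarkovKernel (X.condPosterior sel P s t) := fun s => by
    unfold condPosterior; infer_instance
  piKernel fun s => (X.condPosterior sel P s t).comap (fun p => (p.1 s, p.2)) (by fun_prop)

/-- Hierarchical Thompson sampling in the hierarchical linear bandit with hyper-prior `N(μ_q, Σ_q)`,
task prior covariance `Σ₀`, noise variance `σ²` and at most `n` interactions with each task. -/
structure IsHierTS (μq : Vec d) (Sq S0 : Matrix (Fin d) (Fin d) ℝ) (σ : ℝ) (n : ℕ) : Prop where
  measurable_muStar : Measurable X.muStar
  measurable_thetaStar : ∀ s, Measurable (X.thetaStar s)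
  measurable_tasks : ∀ t, Measurable (X.tasks t)
  measurable_muSample : ∀ t, Measurable (X.muSample t)
  measurable_thetaSample : ∀ s t, Measurable (X.thetaSample s t)
  measurable_reward : ∀ s t, Measurable (X.reward s t)
  /-- `μ_* ∼ N(μ_q, Σ_q)` -/
  muStar_law : HasLaw X.muStar (multivariateGaussian μq Sq) P
  /-- given `μ_*`, the `θ_{s,*}` are i.i.d. with law `N(μ_*, Σ₀)` -/
  thetaStar_law : HasCondDistrib (fun ω s => X.thetaStar s ω) X.muStar
    (piKernel fun _ : Fin m => gaussKernel S0) P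
  /-- `𝒮_t` depends arbitrarily (possibly with extra randomization) on the history `H_t`, and on
  the environment only through it -/
  tasks_law : ∀ t, ∃ ν : Kernel (Hist d m t) (Finset (Fin m)), IsMarkovKernel ν ∧
    HasCondDistrib (X.tasks t) (fun ω => (X.env ω, X.hist sel t ω)) (Kernel.prodMkLeft _ ν) P
  /-- the agent acts at most `n` times in each task -/
  tasks_card : ∀ s, ∀ᵐ ω ∂P, {t | s ∈ X.tasks t ω}.encard ≤ n
  /-- `μ_t ∼ Q_t`, using no information but the history -/
  muSample_law : ∀ t, HasCondDistrib (X.muSample t)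
    (fun ω => ((X.env ω, X.tasks t ω), X.hist sel t ω))
    (Kernel.prodMkLeft _ (X.hyperPosterior sel P t)) P
  /-- `θ_{s,t} ∼ P_{s,t}(· | μ_t)`, using no information but the history and `μ_t` -/
  thetaSample_law : ∀ t, HasCondDistrib (fun ω s => X.thetaSample s t ω)
    (fun ω => ((X.env ω, X.tasks t ω), (X.hist sel t ω, X.muSample t ω)))
    (Kernel.prodMkLeft _ (X.sampleKernel sel P t)) P
  /-- given the past and the actions of round `t`, the rewards `Y_{s,t}` are independent with laws
  `N(A_{s,t}ᵀ θ_{s,*}, σ²)` -/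
  reward_law : ∀ t, HasCondDistrib (fun ω s => X.reward s t ω)
    (fun ω => ((X.muStar ω, X.tasks t ω, X.hist sel t ω),
      fun s => (X.thetaStar s ω, X.action sel s t ω)))
    (Kernel.prodMkLeft _ (piKernel fun s : Fin m =>
      (rewardKernel d σ).comap (fun p : Fin m → Vec d × Vec d => p s) (measurable_pi_apply s))) P

/-- The posterior covariance `Σ̂_{s,t}(ω)` of `θ_{s,*}` given `H_t`. -/
def postCov (s : Fin m) (t : ℕ) (ω : Ω) : Matrix (Fin d) (Fin d) ℝ := fun i j =>
  cov[fun θ : Vec d => θ i, fun θ : Vec d => θ j;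
    condDistrib (X.thetaStar s) (X.hist sel t) P (X.hist sel t ω)]

/-- The total regret `∑_t ∑_{s ∈ 𝒮_t} (A_{s,*}ᵀ θ_{s,*} - A_{s,t}ᵀ θ_{s,*})` of a run. -/
def regret (ω : Ω) : ℝ :=
  ∑' t : ℕ, ∑ s ∈ X.tasks t ω,
    (inner ℝ (X.optAction sel s ω) (X.thetaStar s ω) -
      inner ℝ (X.action sel s t ω) (X.thetaStar s ω))

/-- The sum `∑_t ∑_{s ∈ 𝒮_t} A_{s,t}ᵀ Σ̂_{s,t} A_{s,t}` of posterior variances of a run. -/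
def sumPostVar (ω : Ω) : ℝ :=
  ∑' t : ℕ, ∑ s ∈ X.tasks t ω,
    (X.action sel s t ω).ofLp ⬝ᵥ (X.postCov sel P s t ω *ᵥ (X.action sel s t ω).ofLp)

/-- The Bayes regret. -/
def bayesRegret : ℝ := ∫ ω, X.regret sel ω ∂P

/-- The expected sum `𝒱(m, n)` of posterior variances. -/
def expPostVar : ℝ := ∫ ω, X.sumPostVar sel P ω ∂P

end Interaction

end HierBandit

end

/-!
Thompson sampling draws `θ_{s,t}` from the posterior of `θ_{s,*}` given `H_t`. Hence, given `H_t`,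
the action `A_{s,t} = sel θ_{s,t}` has the law of `A_{s,*} = sel θ_{s,*}` and is independent of
`θ_{s,*}`, so that the regret of task `s` in round `t` has the conditional mean
`∫ (sel θ)ᵀ (θ - m) dπ(θ)`, where `π` is the posterior and `m` its mean
(`setIntegral_roundRegret`). The posterior `π` is Gaussian. For a Gaussian vector `θ = m + B z` with
`z` standard and `B` self-adjoint, one has `aᵀ (θ - m) ≤ ‖B a‖ ‖z‖ ≤ √d ‖B a‖ ‖z‖_∞`, where `‖B a‖²`
is the variance `aᵀ Σ̂ a`; the part of `‖z‖_∞` beyond `c = √(2 log (1 / δ))` contributes at most `d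
√(2/π) δ` to the mean (`integral_inner_sel_sub_mean_le`). For a finite action set, a union bound
over the actions replaces the union bound over the coordinates
(`integral_inner_sel_sub_mean_le_of_finite`). Summing over the at most `m n` active pairs `(s, t)`
and using the Cauchy–Schwarz inequality gives the theorem (`integral_tsum_sum_mem_le`).

What remains is to identify the posterior. The tasks and actions of a round depend on the
environment `(μ_*, (θ_{s,*})_s)` only through the history, so they drop out of the likelihood: the
joint law of environment and history has the Gaussian likelihood `exp (histLL σ θ h)` as its density
with respect to the product of the prior and a reference law of histories (`exists_joint_law`, by
induction on the round). By Bayes' rule (`hasCondDistrib_tiltedKernel`) the posterior of the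
environment is the prior, tilted by a concave quadratic function; it is Gaussian, and its variances
are at most those of the prior (`tilted_sum_quadratic`), hence at most `σ_max²` in the task
parameters (`variance_inner_prior_le`). Given `μ_*`, prior and likelihood factorize over the tasks;
hence the law of `θ_{s,*}` given `(μ_*, H_t)` depends only on `μ_*` and `H_{s,t}`
(`thetaStar_condPosterior`), and the two stages of hierarchical sampling do produce a sample from
the posterior of `θ_{s,*}` given `H_t` (`thetaSample_posterior`).
-/

noncomputable section

namespace HierBandit

/-! ### Tails of Gaussian measures -/

/-- The part `|x| 1{c < |x|}` of `|x|` beyond the threshold `c`. -/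
def tailAbs (c x : ℝ) : ℝ := if c < |x| then |x| else 0

lemma tailAbs_nonneg (c x : ℝ) : 0 ≤ tailAbs c x := by
  unfold tailAbs; split_ifs <;> positivity

lemma abs_le_add_tailAbs {c : ℝ} (hc : 0 ≤ c) (x : ℝ) : |x| ≤ c + tailAbs c x := by
  unfold tailAbs; split_ifs with h <;> linarith

lemma tailAbs_le_abs (c x : ℝ) : tailAbs c x ≤ |x| := by
  unfold tailAbs; split_ifs <;> simp

@[fun_prop]
lemma measurable_tailAbs (c : ℝ) : Measurable (tailAbs c) :=
  Measurable.ite (measurableSet_lt (by fun_prop) (by fun_prop)) (by fun_prop) (by fun_prop)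

lemma integrable_tailAbs_comp {α : Type*} [MeasurableSpace α] {μ : Measure α} {f : α → ℝ}
    (hf : Integrable f μ) (c : ℝ) : Integrable (fun x => tailAbs c (f x)) μ := by
  refine hf.mono ((measurable_tailAbs c).comp_aemeasurable hf.aemeasurable).aestronglyMeasurable ?_
  filter_upwards with x
  simpa [abs_of_nonneg (tailAbs_nonneg c (f x))] using tailAbs_le_abs c (f x)

lemma integral_tailAbs_gaussianReal_one {c : ℝ} (hc : 0 ≤ c) :
    ∫ x, tailAbs c x ∂(gaussianReal 0 1) = √(2 / Real.pi) * Real.exp (-c ^ 2 / 2) := by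
  rw [integral_gaussianReal_eq_integral_smul (by simp)]
  set f : ℝ → ℝ := (Set.Ioi c).indicator fun x => (√(2 * Real.pi))⁻¹ * (x * Real.exp (-x ^ 2 / 2))
  have h1 : ∀ x, gaussianPDFReal 0 1 x • tailAbs c x = f |x| := by
    intro x
    simp only [gaussianPDFReal, tailAbs, f, Set.indicator_apply, Set.mem_Ioi]
    split_ifs with h
    · simp; ring
    · simp
  simp_rw [h1]
  rw [integral_comp_abs (f := f), setIntegral_indicator measurableSet_Ioi, Set.Ioi_inter_Ioi,
    max_eq_right hc, integral_const_mul]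
  have hd : ∀ x ∈ Set.Ici c, HasDerivAt (fun x : ℝ => -Real.exp (-x ^ 2 / 2))
      (x * Real.exp (-x ^ 2 / 2)) x := by
    intro x _
    have h := (((hasDerivAt_pow 2 x).neg.div_const 2).exp).neg
    convert! h using 1
    simp; ring
  have hlim : Filter.Tendsto (fun x : ℝ => -Real.exp (-x ^ 2 / 2)) Filter.atTop (nhds 0) := by
    rw [← neg_zero]
    refine (Real.tendsto_exp_atBot.comp ?_).neg
    have : Filter.Tendsto (fun x : ℝ => x ^ 2 / 2) Filter.atTop Filter.atTop :=
      (Filter.tendsto_pow_atTop two_ne_zero).atTop_div_const (by norm_num)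
    refine (Filter.tendsto_neg_atTop_atBot.comp this).congr fun x => ?_
    simp only [Function.comp]; ring
  have hpos : ∀ x ∈ Set.Ioi c, 0 ≤ x * Real.exp (-x ^ 2 / 2) := fun x hx =>
    mul_nonneg (hc.trans (le_of_lt hx)) (Real.exp_nonneg _)
  rw [integral_Ioi_of_hasDerivAt_of_nonneg' hd hpos hlim]
  have : √(2 / Real.pi) = 2 * (√(2 * Real.pi))⁻¹ := by
    rw [Real.sqrt_div (by norm_num), Real.sqrt_mul (by norm_num)]
    have h2 : √2 * √2 = 2 := Real.mul_self_sqrt (by norm_num)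
    have : 0 < √Real.pi := Real.sqrt_pos.2 Real.pi_pos
    field_simp
    linarith
  rw [this]; ring

lemma integral_tailAbs_gaussianReal_le {c : ℝ} (hc : 0 ≤ c) {s : ℝ} (hs : 0 ≤ s) :
    ∫ x, tailAbs (c * s) x ∂(gaussianReal 0 (s ^ 2).toNNReal) ≤
      s * (√(2 / Real.pi) * Real.exp (-c ^ 2 / 2)) := by
  have hmap := gaussianReal_map_const_mul (μ := 0) (v := 1) s
  have hv : (NNReal.mk (s ^ 2) (sq_nonneg s) : NNReal) * 1 = (s ^ 2).toNNReal := by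
    rw [mul_one]; ext; simp [sq_nonneg]
  rw [mul_zero, hv] at hmap
  rw [← hmap, integral_map (by fun_prop) (by fun_prop), ← integral_tailAbs_gaussianReal_one hc,
    ← integral_const_mul]
  have hi : Integrable (fun x : ℝ => x) (gaussianReal 0 1) := IsGaussian.integrable_id
  refine integral_mono (integrable_tailAbs_comp (hi.const_mul s) _)
    ((integrable_tailAbs_comp hi c).const_mul s) fun x => ?_
  rcases hs.eq_or_lt with rfl | hs'
  · simp [tailAbs]
  · simp only [tailAbs, abs_mul, abs_of_pos hs', mul_comm c s, mul_lt_mul_iff_right₀ hs']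
    split_ifs <;> simp

section stdGaussian

variable {E : Type*} [NormedAddCommGroup E] [InnerProductSpace ℝ E] [FiniteDimensional ℝ E]
  [MeasurableSpace E] [BorelSpace E]

lemma integrable_inner_stdGaussian (u : E) :
    Integrable (fun z : E => inner ℝ u z) (stdGaussian E) :=
  IsGaussian.integrable_dual (stdGaussian E) (innerSL ℝ u)

lemma integral_tailAbs_inner_stdGaussian_le {c : ℝ} (hc : 0 ≤ c) (u : E) :
    ∫ z, tailAbs (c * ‖u‖) (inner ℝ u z) ∂(stdGaussian E) ≤
      ‖u‖ * (√(2 / Real.pi) * Real.exp (-c ^ 2 / 2)) := by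
  have h := IsGaussian.map_eq_gaussianReal (μ := stdGaussian E) (innerSL ℝ u)
  rw [integral_strongDual_stdGaussian, variance_dual_stdGaussian, innerSL_apply_norm] at h
  refine le_trans (le_of_eq ?_) (integral_tailAbs_gaussianReal_le hc (norm_nonneg u))
  rw [← h, integral_map (by fun_prop) (by fun_prop)]
  rfl

end stdGaussian

end HierBandit

namespace HierBandit

/-! ### Gaussian measures on `ℝ^d` -/

variable {d : ℕ}

/-- The covariance matrix of a measure on `ℝ^d`. -/
def covMat (π : Measure (Vec d)) : Matrix (Fin d) (Fin d) ℝ := fun i j =>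
  cov[fun θ : Vec d => θ i, fun θ : Vec d => θ j; π]

/-- The quadratic form `aᵀ M a`. -/
def quadForm (M : Matrix (Fin d) (Fin d) ℝ) (a : Vec d) : ℝ := a.ofLp ⬝ᵥ (M *ᵥ a.ofLp)

lemma covarianceBilin_eq_covMat {π : Measure (Vec d)} [IsFiniteMeasure π] (h : MemLp id 2 π)
    (x y : Vec d) : covarianceBilin π x y = x.ofLp ⬝ᵥ (covMat π *ᵥ y.ofLp) := by
  have hX : ∀ i, MemLp (fun θ : Vec d => θ i) 2 π := fun i =>
    (EuclideanSpace.proj (𝕜 := ℝ) i).comp_memLp' h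
  have := covarianceBilin_apply_pi hX x y
  have hid : (fun ω : Vec d => WithLp.toLp 2 fun i => ω i) = id := rfl
  rw [hid, Measure.map_id] at this
  rw [this]
  simp only [dotProduct, Matrix.mulVec, covMat, Finset.mul_sum]
  refine Finset.sum_congr rfl fun i _ => Finset.sum_congr rfl fun j _ => ?_
  ring

lemma quadForm_covMat {π : Measure (Vec d)} [IsFiniteMeasure π] (h : MemLp id 2 π) (a : Vec d) :
    quadForm (covMat π) a = Var[fun θ => inner ℝ a θ; π] := by
  rw [← covarianceBilin_self h, covarianceBilin_eq_covMat h, quadForm]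

lemma posSemidef_covMat {π : Measure (Vec d)} [IsFiniteMeasure π] (h : MemLp id 2 π) :
    (covMat π).PosSemidef := by
  refine Matrix.PosSemidef.of_dotProduct_mulVec_nonneg ?_ fun x => ?_
  · ext i j; simp [covMat, covariance_comm]
  · have := quadForm_covMat h (WithLp.toLp 2 x)
    simp only [quadForm] at this
    simp only [star_trivial]
    rw [this]
    exact variance_nonneg _ _

lemma IsGaussian.eq_multivariateGaussian (π : Measure (Vec d)) [IsGaussian π] :
    π = multivariateGaussian (∫ θ, θ ∂π) (covMat π) := by
  refine IsGaussian.ext (by simp) ?_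
  ext x y
  rw [covarianceBilin_multivariateGaussian (posSemidef_covMat IsGaussian.memLp_two_id),
    covarianceBilin_eq_covMat IsGaussian.memLp_two_id]

section
open scoped MatrixOrder

/-- A Gaussian vector `θ` on `ℝ^d` is an affine image `m + B z` of a standard Gaussian vector,
where `B`, the square root of the covariance matrix, is self-adjoint. -/
lemma exists_map_stdGaussian (π : Measure (Vec d)) [IsGaussian π] :
    ∃ B : Vec d →L[ℝ] Vec d, (∀ x y, inner ℝ x (B y) = inner ℝ (B x) y) ∧
      (∀ a, quadForm (covMat π) a = ‖B a‖ ^ 2) ∧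
      π = (stdGaussian (Vec d)).map fun z => (∫ θ, θ ∂π) + B z := by
  have hS := posSemidef_covMat (π := π) IsGaussian.memLp_two_id
  set B : Vec d →L[ℝ] Vec d := Matrix.toEuclideanCLM (𝕜 := ℝ) (CFC.sqrt (covMat π)) with hB
  have hadj : IsSelfAdjoint B := (CFC.sqrt_nonneg (covMat π)).isSelfAdjoint.map _
  have hsymm : ∀ x y, inner ℝ x (B y) = inner ℝ (B x) y := by
    intro x y
    rw [← ContinuousLinearMap.adjoint_inner_left, hadj.adjoint_eq]
  refine ⟨B, hsymm, fun a => ?_, IsGaussian.eq_multivariateGaussian π⟩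
  have hBB : B * B = Matrix.toEuclideanCLM (𝕜 := ℝ) (covMat π) := by
    rw [hB, ← map_mul, CFC.sqrt_mul_sqrt_self _ hS.nonneg]
  have : inner ℝ a ((B * B) a) = quadForm (covMat π) a := by
    rw [hBB, Matrix.inner_toEuclideanCLM, quadForm]
  rw [← this, mul_apply_eq_comp, hsymm, real_inner_self_eq_norm_sq]

end

variable {sel : Vec d → Vec d}

lemma integrable_sqrt_quadForm_covMat {π : Measure (Vec d)} [IsGaussian π]
    (hm : Measurable sel) (h1 : ∀ θ, ‖sel θ‖ ≤ 1) :
    Integrable (fun θ => √(quadForm (covMat π) (sel θ))) π := by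
  obtain ⟨B, -, hq, -⟩ := exists_map_stdGaussian π
  simp_rw [hq, Real.sqrt_sq (norm_nonneg _)]
  refine Integrable.of_bound (C := ‖B‖) (by fun_prop) (ae_of_all _ fun θ => ?_)
  rw [norm_norm]
  exact (B.le_opNorm _).trans (mul_le_of_le_one_right (norm_nonneg _) (h1 θ))

lemma integrable_inner_sel_sub {π : Measure (Vec d)} [IsFiniteMeasure π]
    (hπ : Integrable id π) (hm : Measurable sel) (h1 : ∀ θ, ‖sel θ‖ ≤ 1) (c : Vec d) :
    Integrable (fun θ => inner ℝ (sel θ) (θ - c)) π := by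
  have hi : Integrable (fun θ : Vec d => θ - c) π := hπ.sub (integrable_const c)
  refine hi.mono (by fun_prop) (ae_of_all _ fun θ => ?_)
  exact (norm_inner_le_norm _ _).trans (mul_le_of_le_one_left (norm_nonneg _) (h1 θ))

lemma norm_le_sqrt_mul_tailAbs {c : ℝ} (hc : 0 ≤ c) (z : Vec d) :
    ‖z‖ ≤ √d * (c + ∑ i, tailAbs c (z i)) := by
  have hM : 0 ≤ c + ∑ i, tailAbs c (z i) :=
    add_nonneg hc (Finset.sum_nonneg fun i _ => tailAbs_nonneg _ _)
  have hi : ∀ i, |z i| ≤ c + ∑ i, tailAbs c (z i) := fun i =>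
    (abs_le_add_tailAbs hc (z i)).trans <| by
      gcongr
      exact Finset.single_le_sum (f := fun i => tailAbs c (z i))
        (fun i _ => tailAbs_nonneg _ _) (Finset.mem_univ i)
  rw [EuclideanSpace.norm_eq, ← Real.sqrt_sq hM, ← Real.sqrt_mul (by positivity)]
  refine Real.sqrt_le_sqrt ?_
  calc ∑ i, ‖z i‖ ^ 2 ≤ ∑ _i : Fin d, (c + ∑ i, tailAbs c (z i)) ^ 2 := by
        gcongr with i; exact hi i
    _ = _ := by simp

/-- If `a = sel θ` is a function of the Gaussian vector `θ = m + B z`, then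
`aᵀ (θ - m) ≤ ‖B a‖ ‖z‖`, and `‖z‖ ≤ √d ‖z‖_∞`, where `‖z‖_∞` exceeds `c` only with a
small contribution to the mean. -/
lemma integral_inner_sel_sub_mean_le {π : Measure (Vec d)} [IsGaussian π]
    (hm : Measurable sel) (h1 : ∀ θ, ‖sel θ‖ ≤ 1) {s : ℝ} (hs : 0 ≤ s)
    (hV : ∀ a, quadForm (covMat π) a ≤ s ^ 2 * ‖a‖ ^ 2) {c : ℝ} (hc : 0 ≤ c) :
    ∫ θ, inner ℝ (sel θ) (θ - ∫ θ, θ ∂π) ∂π ≤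
      √d * c * ∫ θ, √(quadForm (covMat π) (sel θ)) ∂π +
        √d * d * s * (√(2 / Real.pi) * Real.exp (-c ^ 2 / 2)) := by
  obtain ⟨B, hsymm, hq, hπ⟩ := exists_map_stdGaussian π
  set m := ∫ θ, θ ∂π
  have hi1 := integrable_inner_sel_sub (π := π) IsGaussian.integrable_id hm h1 m
  have hi2 := integrable_sqrt_quadForm_covMat (π := π) hm h1
  have hmap : Measurable fun z : Vec d => m + B z := by fun_prop
  have e1 : ∀ f : Vec d → ℝ, Measurable f →
      ∫ θ, f θ ∂π = ∫ z, f (m + B z) ∂(stdGaussian (Vec d)) := by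
    intro f hf
    conv_lhs => rw [hπ]
    rw [integral_map hmap.aemeasurable hf.aestronglyMeasurable]
  have e2 : ∀ f : Vec d → ℝ, Integrable f π →
      Integrable (fun z => f (m + B z)) (stdGaussian (Vec d)) := by
    intro f hf
    rw [hπ] at hf
    exact hf.comp_measurable hmap
  have hBa : ∀ a, ‖a‖ ≤ 1 → ‖B a‖ ≤ s := by
    intro a ha
    refine abs_le_of_sq_le_sq' ?_ hs |>.2
    rw [← hq]
    refine (hV a).trans (mul_le_of_le_one_right (sq_nonneg s) ?_)
    exact pow_le_one₀ (norm_nonneg _) ha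
  have hcoord : ∀ i (z : Vec d), inner ℝ (EuclideanSpace.basisFun (Fin d) ℝ i) z = z i :=
    fun i z => EuclideanSpace.basisFun_inner (Fin d) ℝ z i
  have htail : ∀ i : Fin d, Integrable (fun z : Vec d => tailAbs c (z i)) (stdGaussian (Vec d)) :=
    fun i => by
      have := integrable_tailAbs_comp
        (integrable_inner_stdGaussian (EuclideanSpace.basisFun (Fin d) ℝ i)) c
      simpa only [hcoord] using this
  have htail_le : ∀ i : Fin d, ∫ z : Vec d, tailAbs c (z i) ∂(stdGaussian (Vec d)) ≤
      √(2 / Real.pi) * Real.exp (-c ^ 2 / 2) := fun i => by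
    have := integral_tailAbs_inner_stdGaussian_le hc (EuclideanSpace.basisFun (Fin d) ℝ i)
    simpa only [hcoord, OrthonormalBasis.norm_eq_one, mul_one, one_mul] using this
  have hsum : Integrable (fun z : Vec d => √d * s * ∑ i, tailAbs c (z i))
      (stdGaussian (Vec d)) := (integrable_finsetSum _ fun i _ => htail i).const_mul _
  rw [e1 _ (by fun_prop), e1 (fun θ => √(quadForm (covMat π) (sel θ)))
    (by simp_rw [hq]; fun_prop)]
  calc ∫ z, inner ℝ (sel (m + B z)) (m + B z - m) ∂(stdGaussian (Vec d))
      ≤ ∫ z, (√d * c * √(quadForm (covMat π) (sel (m + B z))) +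
          √d * s * ∑ i, tailAbs c (z i)) ∂(stdGaussian (Vec d)) := by
        refine integral_mono (e2 _ hi1) (((e2 _ hi2).const_mul _).add hsum) fun z => ?_
        simp only [hq, Real.sqrt_sq (norm_nonneg _), add_sub_cancel_left, hsymm]
        set a := sel (m + B z)
        have hT : 0 ≤ ∑ i, tailAbs c (z i) := Finset.sum_nonneg fun i _ => tailAbs_nonneg _ _
        calc inner ℝ (B a) z ≤ ‖B a‖ * ‖z‖ := real_inner_le_norm _ _
          _ ≤ ‖B a‖ * (√d * (c + ∑ i, tailAbs c (z i))) := by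
            gcongr; exact norm_le_sqrt_mul_tailAbs hc z
          _ = √d * c * ‖B a‖ + √d * ‖B a‖ * ∑ i, tailAbs c (z i) := by ring
          _ ≤ _ := by
            gcongr; exact hBa _ (h1 _)
    _ = √d * c * ∫ z, √(quadForm (covMat π) (sel (m + B z))) ∂(stdGaussian (Vec d)) +
          √d * s * ∑ i, ∫ z : Vec d, tailAbs c (z i) ∂(stdGaussian (Vec d)) := by
        rw [integral_add ((e2 _ hi2).const_mul _) hsum, integral_const_mul, integral_const_mul,
          integral_finsetSum _ fun i _ => htail i]
    _ ≤ √d * c * ∫ z, √(quadForm (covMat π) (sel (m + B z))) ∂(stdGaussian (Vec d)) +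
          √d * s * ∑ _i : Fin d, √(2 / Real.pi) * Real.exp (-c ^ 2 / 2) := by
        gcongr with i; exact htail_le i
    _ = _ := by simp; ring

/-- The bound for finite action sets: `aᵀ (θ - m)` exceeds `c` of its standard deviations only
with a small contribution to the mean, for each of the finitely many `a`. -/
lemma integral_inner_sel_sub_mean_le_of_finite {π : Measure (Vec d)} [IsGaussian π]
    {𝒜 : Set (Vec d)} (hfin : 𝒜.Finite) (hmem : ∀ θ, sel θ ∈ 𝒜)
    (hm : Measurable sel) (h1 : ∀ a ∈ 𝒜, ‖a‖ ≤ 1) {s : ℝ} (hs : 0 ≤ s)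
    (hV : ∀ a, quadForm (covMat π) a ≤ s ^ 2 * ‖a‖ ^ 2) {c : ℝ} (hc : 0 ≤ c) :
    ∫ θ, inner ℝ (sel θ) (θ - ∫ θ, θ ∂π) ∂π ≤
      c * ∫ θ, √(quadForm (covMat π) (sel θ)) ∂π +
        𝒜.ncard * s * (√(2 / Real.pi) * Real.exp (-c ^ 2 / 2)) := by
  obtain ⟨B, hsymm, hq, hπ⟩ := exists_map_stdGaussian π
  set m := ∫ θ, θ ∂π
  have hi1 := integrable_inner_sel_sub (π := π) IsGaussian.integrable_id hm
    (fun θ => h1 _ (hmem θ)) m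
  have hi2 := integrable_sqrt_quadForm_covMat (π := π) hm (fun θ => h1 _ (hmem θ))
  have hmap : Measurable fun z : Vec d => m + B z := by fun_prop
  have e1 : ∀ f : Vec d → ℝ, Measurable f →
      ∫ θ, f θ ∂π = ∫ z, f (m + B z) ∂(stdGaussian (Vec d)) := by
    intro f hf
    conv_lhs => rw [hπ]
    rw [integral_map hmap.aemeasurable hf.aestronglyMeasurable]
  have e2 : ∀ f : Vec d → ℝ, Integrable f π →
      Integrable (fun z => f (m + B z)) (stdGaussian (Vec d)) := by
    intro f hf
    rw [hπ] at hf
    exact hf.comp_measurable hmap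
  have hBa : ∀ a, ‖a‖ ≤ 1 → ‖B a‖ ≤ s := by
    intro a ha
    refine abs_le_of_sq_le_sq' ?_ hs |>.2
    rw [← hq]
    refine (hV a).trans (mul_le_of_le_one_right (sq_nonneg s) ?_)
    exact pow_le_one₀ (norm_nonneg _) ha
  set A := hfin.toFinset
  have htail : ∀ a, Integrable (fun z : Vec d => tailAbs (c * ‖B a‖) (inner ℝ (B a) z))
      (stdGaussian (Vec d)) := fun a => integrable_tailAbs_comp (integrable_inner_stdGaussian _) _
  have hsum : Integrable (fun z : Vec d => ∑ a ∈ A, tailAbs (c * ‖B a‖) (inner ℝ (B a) z))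
      (stdGaussian (Vec d)) := integrable_finsetSum _ fun a _ => htail a
  rw [e1 _ (by fun_prop), e1 (fun θ => √(quadForm (covMat π) (sel θ)))
    (by simp_rw [hq]; fun_prop)]
  calc ∫ z, inner ℝ (sel (m + B z)) (m + B z - m) ∂(stdGaussian (Vec d))
      ≤ ∫ z, (c * √(quadForm (covMat π) (sel (m + B z))) +
          ∑ a ∈ A, tailAbs (c * ‖B a‖) (inner ℝ (B a) z)) ∂(stdGaussian (Vec d)) := by
        refine integral_mono (e2 _ hi1) (((e2 _ hi2).const_mul _).add hsum) fun z => ?_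
        simp only [hq, Real.sqrt_sq (norm_nonneg _), add_sub_cancel_left, hsymm]
        have ha : sel (m + B z) ∈ A := hfin.mem_toFinset.2 (hmem _)
        refine (le_abs_self _).trans ((abs_le_add_tailAbs (c := c * ‖B (sel (m + B z))‖)
          (by positivity) _).trans ?_)
        gcongr
        exact Finset.single_le_sum (f := fun a => tailAbs (c * ‖B a‖) (inner ℝ (B a) z))
          (fun a _ => tailAbs_nonneg _ _) ha
    _ = c * ∫ z, √(quadForm (covMat π) (sel (m + B z))) ∂(stdGaussian (Vec d)) +
          ∑ a ∈ A, ∫ z : Vec d, tailAbs (c * ‖B a‖) (inner ℝ (B a) z) ∂(stdGaussian (Vec d)) := by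
        rw [integral_add ((e2 _ hi2).const_mul _) hsum, integral_const_mul,
          integral_finsetSum _ fun a _ => htail a]
    _ ≤ c * ∫ z, √(quadForm (covMat π) (sel (m + B z))) ∂(stdGaussian (Vec d)) +
          ∑ _a ∈ A, s * (√(2 / Real.pi) * Real.exp (-c ^ 2 / 2)) := by
        gcongr with a ha
        refine (integral_tailAbs_inner_stdGaussian_le hc (B a)).trans ?_
        gcongr
        exact hBa _ (h1 _ (hfin.mem_toFinset.1 ha))
    _ = _ := by
        rw [Finset.sum_const, nsmul_eq_mul, Set.ncard_eq_toFinset_card _ hfin]; ring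

end HierBandit

namespace HierBandit

/-! ### Tilting Gaussian measures by concave quadratics -/

lemma tilted_map {α β : Type*} [MeasurableSpace α] [MeasurableSpace β] {μ : Measure α}
    {T : α → β} (hT : Measurable T) {g : β → ℝ} (hg : Measurable g) :
    (μ.map T).tilted g = (μ.tilted (g ∘ T)).map T := by
  refine Measure.ext_of_lintegral _ fun φ hφ => ?_
  have hgm : AEStronglyMeasurable (fun x => Real.exp (g x)) (μ.map T) :=
    (Real.measurable_exp.comp hg).aestronglyMeasurable
  rw [lintegral_tilted, lintegral_map hφ hT, lintegral_tilted, lintegral_map (by fun_prop) hT,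
    integral_map hT.aemeasurable hgm]
  rfl

lemma prod_tilted {α β : Type*} [MeasurableSpace α] [MeasurableSpace β] (μ : Measure α)
    [IsProbabilityMeasure μ] (ν : Measure β) [IsProbabilityMeasure ν] {g : β → ℝ}
    (hg : Measurable g) :
    (μ.prod ν).tilted (fun p => g p.2) = μ.prod (ν.tilted g) := by
  have h : ∫ p : α × β, Real.exp (g p.2) ∂(μ.prod ν) = ∫ y, Real.exp (g y) ∂ν := by
    have := integral_fun_snd (μ := μ) (ν := ν) (fun y => Real.exp (g y))
    simpa using this
  rw [Measure.tilted, Measure.tilted, h, prod_withDensity_right (by fun_prop)]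

lemma mul_sub_mul_sq_le {β : ℝ} (hβ : 0 < β) (α x : ℝ) :
    α * x - β * x ^ 2 ≤ α ^ 2 / (4 * β) := by
  rw [le_div_iff₀ (by positivity)]
  nlinarith [sq_nonneg (α - 2 * β * x)]

/-- Completing the square: tilting `N(m, v)` by `exp (α x - β x²)` gives a Gaussian law with
precision `1 / v + 2 β`. -/
lemma exists_tilted_gaussianReal (m : ℝ) (v : NNReal) (α : ℝ) {β : ℝ} (hβ : 0 < β) :
    ∃ m' : ℝ, ∃ v' : NNReal, v' ≤ v ∧
      (gaussianReal m v).tilted (fun x => α * x - β * x ^ 2) = gaussianReal m' v' := by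
  -- for `v = 0` the law is a Dirac mass, which tilting does not change
  by_cases hv : v = 0
  · subst hv
    refine ⟨m, 0, le_rfl, ?_⟩
    rw [gaussianReal_zero_var, tilted_congr (g := fun _ => α * m - β * m ^ 2), tilted_const]
    rw [Filter.EventuallyEq, ae_dirac_eq]
    rfl
  have hv0 : (0 : ℝ) < v := by positivity
  set w : ℝ := v / (1 + 2 * β * v) with hw
  have hwpos : 0 < w := by positivity
  set m' : ℝ := w * (m / v + α) with hm'
  set v' : NNReal := ⟨w, hwpos.le⟩
  have hv'w : (v' : ℝ) = w := rfl
  have hv' : v' ≠ 0 := fun h => hwpos.ne' (by rw [← hv'w, h]; rfl)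
  refine ⟨m', v', ?_, ?_⟩
  · rw [← NNReal.coe_le_coe, hv'w, hw]
    exact div_le_self hv0.le (by nlinarith [mul_pos hβ hv0])
  set K : ℝ := (√(2 * Real.pi * v))⁻¹ * √(2 * Real.pi * w) *
    Real.exp (m' ^ 2 / (2 * w) - m ^ 2 / (2 * v)) with hK
  have hKpos : 0 < K := by positivity
  have hpdf : ∀ x, gaussianPDFReal m v x * Real.exp (α * x - β * x ^ 2) =
      K * gaussianPDFReal m' v' x := by
    intro x
    have hs : √(2 * Real.pi * w) ≠ 0 := by positivity
    simp only [gaussianPDFReal, hv'w, hK]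
    have hexp : -(x - m) ^ 2 / (2 * v) + (α * x - β * x ^ 2) =
        m' ^ 2 / (2 * w) - m ^ 2 / (2 * v) + -(x - m') ^ 2 / (2 * w) := by
      have h1 : m' ^ 2 / (2 * w) + -(x - m') ^ 2 / (2 * w) = x * (m' / w) - x ^ 2 / (2 * w) := by
        field_simp; ring
      have h2 : m' / w = m / v + α := by rw [hm']; field_simp
      have h3 : x ^ 2 / (2 * w) = x ^ 2 / (2 * v) + β * x ^ 2 := by rw [hw]; field_simp
      have h4 : m' ^ 2 / (2 * w) - m ^ 2 / (2 * v) + -(x - m') ^ 2 / (2 * w) =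
        (m' ^ 2 / (2 * w) + -(x - m') ^ 2 / (2 * w)) - m ^ 2 / (2 * v) := by ring
      rw [h4, h1, h2, h3]; field_simp; ring
    rw [mul_assoc, ← Real.exp_add, hexp, Real.exp_add]
    field_simp
  have hZ : ∫ x, Real.exp (α * x - β * x ^ 2) ∂(gaussianReal m v) = K := by
    rw [integral_gaussianReal_eq_integral_smul hv]
    simp_rw [smul_eq_mul, hpdf]
    rw [integral_const_mul, integral_gaussianPDFReal_eq_one _ hv', mul_one]
  rw [Measure.tilted, hZ, gaussianReal_of_var_ne_zero _ hv, gaussianReal_of_var_ne_zero _ hv',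
    ← withDensity_mul _ (measurable_gaussianPDF _ _) (by fun_prop)]
  congr 1
  ext x
  simp only [Pi.mul_apply, gaussianPDF]
  rw [← ENNReal.ofReal_mul (gaussianPDFReal_nonneg _ _ _), mul_div_assoc', hpdf]
  congr 1
  field_simp

section

variable {E : Type*} [NormedAddCommGroup E] [NormedSpace ℝ E] [MeasurableSpace E] [BorelSpace E]

/-- Given a linear functional `φ`, write `φ = ψ + c x`, where `ψ` and `x` are uncorrelated, hence
independent, under `μ`. The tilting by a function of `x` only changes the law of `x`. -/
lemma exists_map_tilted_quadratic (μ : Measure E) [IsGaussian μ] (x : StrongDual ℝ E) (α : ℝ)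
    {β : ℝ} (hβ : 0 < β) (φ : StrongDual ℝ E) :
    ∃ m : ℝ, ∃ v : NNReal, (v : ℝ) ≤ Var[φ; μ] ∧
      (μ.tilted fun e => α * x e - β * x e ^ 2).map φ = gaussianReal m v := by
  have hmem : ∀ L : StrongDual ℝ E, MemLp L 2 μ := fun L => IsGaussian.memLp_dual μ L 2 (by simp)
  -- if `x` is constant, so is the tilting function, and the tilting has no effect
  by_cases hx : Var[x; μ] = 0
  · refine ⟨μ[φ], Var[φ; μ].toNNReal, by rw [Real.coe_toNNReal _ (variance_nonneg _ _)], ?_⟩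
    have hc : x =ᵐ[μ] fun _ => μ[x] := by
      have h := (evariance_eq_zero_iff (μ := μ) (X := x) (by fun_prop)).1 (by
        rw [← (hmem x).ofReal_variance_eq, hx, ENNReal.ofReal_zero])
      exact h
    rw [tilted_congr (g := fun _ => α * μ[x] - β * μ[x] ^ 2), tilted_const,
      IsGaussian.map_eq_gaussianReal]
    filter_upwards [hc] with e he
    rw [he]
  set c : ℝ := cov[φ, x; μ] / Var[x; μ] with hc
  set ψ : StrongDual ℝ E := φ - c • x with hψ
  set g : ℝ → ℝ := fun u => α * u - β * u ^ 2 with hg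
  have hgm : Measurable g := by fun_prop
  have hcov : cov[ψ, x; μ] = 0 := by
    have : (ψ : E → ℝ) = (φ : E → ℝ) - c • (x : E → ℝ) := rfl
    rw [this, covariance_sub_left (hmem φ) ((hmem x).const_smul c) (hmem x),
      covariance_smul_left, covariance_self (by fun_prop), hc, div_mul_cancel₀ _ hx, sub_self]
  have hlaw : HasGaussianLaw (fun e => (ψ e, x e)) μ := by
    have : HasGaussianLaw ((ψ.prod x) ∘ id) μ :=
      IsGaussian.hasGaussianLaw_id.map_of_measurable (ψ.prod x) (by fun_prop)
    exact this
  have hind : IndepFun ψ x μ := hlaw.indepFun_of_covariance_eq_zero hcov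
  have hprod : μ.map (fun e => (ψ e, x e)) = (μ.map ψ).prod (μ.map x) :=
    hind.map_prod_eq_prod_map_map (by fun_prop) (by fun_prop)
  obtain ⟨m', v', hv', htilt⟩ :=
    exists_tilted_gaussianReal (μ[x]) (Var[x; μ].toNNReal) α hβ
  have hpair : (μ.tilted (g ∘ x)).map (fun e => (ψ e, x e)) =
      (gaussianReal (μ[ψ]) (Var[ψ; μ].toNNReal)).prod (gaussianReal m' v') := by
    have h1 := tilted_map (μ := μ) (T := fun e => (ψ e, x e)) (by fun_prop)
      (g := fun p : ℝ × ℝ => g p.2) (by fun_prop)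
    rw [hprod, IsGaussian.map_eq_gaussianReal, IsGaussian.map_eq_gaussianReal, prod_tilted _ _ hgm,
      htilt] at h1
    exact h1.symm
  have hφ : (φ : E → ℝ) = (fun p : ℝ × ℝ => p.1 + c * p.2) ∘ fun e => (ψ e, x e) := by
    ext e; simp [hψ]
  have hadd : ((gaussianReal (μ[ψ]) (Var[ψ; μ].toNNReal)).prod (gaussianReal m' v')).map
      (fun p : ℝ × ℝ => p.1 + c * p.2) =
      gaussianReal (μ[ψ] + c * m') (Var[ψ; μ].toNNReal + NNReal.mk (c ^ 2) (sq_nonneg c) * v') := by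
    rw [← gaussianReal_conv_gaussianReal, ← gaussianReal_map_const_mul, Measure.conv]
    conv_rhs => rw [← Measure.map_id (μ := gaussianReal (μ[ψ]) (Var[ψ; μ].toNNReal))]
    rw [Measure.map_prod_map _ _ (by fun_prop) (by fun_prop),
      Measure.map_map (by fun_prop) (by fun_prop)]
    rfl
  refine ⟨μ[ψ] + c * m', Var[ψ; μ].toNNReal + NNReal.mk (c ^ 2) (sq_nonneg c) * v',
    ?_, ?_⟩
  rotate_left
  · calc (μ.tilted fun e => α * x e - β * x e ^ 2).map φ
        = ((μ.tilted (g ∘ x)).map (fun e => (ψ e, x e))).map (fun p : ℝ × ℝ => p.1 + c * p.2) := by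
          rw [Measure.map_map (by fun_prop) (by fun_prop), ← hφ]; rfl
      _ = _ := by rw [hpair, hadd]
  · have hvar : Var[φ; μ] = Var[ψ; μ] + c ^ 2 * Var[x; μ] := by
      have h1 : (φ : E → ℝ) = (ψ : E → ℝ) + fun e => c * x e := by ext e; simp [hψ]
      have h2 : IndepFun ψ (fun e => c * x e) μ :=
        hind.comp (φ := id) (ψ := fun u => c * u) measurable_id (by fun_prop)
      rw [h1, h2.variance_add (hmem ψ) ((hmem x).const_mul c), variance_const_mul]
    rw [hvar, NNReal.coe_add, Real.coe_toNNReal _ (variance_nonneg _ _), NNReal.coe_mul]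
    have : (v' : ℝ) ≤ Var[x; μ] := by
      rw [← Real.coe_toNNReal (Var[x; μ]) (variance_nonneg _ _)]; exact_mod_cast hv'
    have hc2 : ((NNReal.mk (c ^ 2) (sq_nonneg c) : NNReal) : ℝ) = c ^ 2 := rfl
    rw [hc2]
    gcongr

lemma isGaussian_tilted_quadratic (μ : Measure E) [IsGaussian μ] (x : StrongDual ℝ E) (α : ℝ)
    {β : ℝ} (hβ : 0 < β) :
    IsGaussian (μ.tilted fun e => α * x e - β * x e ^ 2) :=
  isGaussian_of_map_eq_gaussianReal fun φ =>
    let ⟨m, v, _, h⟩ := exists_map_tilted_quadratic μ x α hβ φ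
    ⟨m, v, h⟩

lemma variance_tilted_quadratic_le (μ : Measure E) [IsGaussian μ] (x : StrongDual ℝ E) (α : ℝ)
    {β : ℝ} (hβ : 0 < β) (φ : StrongDual ℝ E) :
    Var[φ; μ.tilted fun e => α * x e - β * x e ^ 2] ≤ Var[φ; μ] := by
  obtain ⟨m, v, hv, h⟩ := exists_map_tilted_quadratic μ x α hβ φ
  refine le_trans (le_of_eq ?_) hv
  have := variance_map (X := id) (μ := μ.tilted fun e => α * x e - β * x e ^ 2) (Y := φ)
    (by fun_prop) (by fun_prop)
  rw [h, variance_id_gaussianReal] at this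
  exact this.symm

lemma integrable_exp_sum_quadratic {ι : Type*} (μ : Measure E) [IsFiniteMeasure μ] (s : Finset ι)
    (x : ι → StrongDual ℝ E) (α : ι → ℝ) {β : ι → ℝ} (hβ : ∀ i, 0 < β i) :
    Integrable (fun e => Real.exp (∑ i ∈ s, (α i * x i e - β i * x i e ^ 2))) μ := by
  refine Integrable.of_bound (C := Real.exp (∑ i ∈ s, α i ^ 2 / (4 * β i)))
    (Measurable.aestronglyMeasurable (by fun_prop)) (ae_of_all _ fun e => ?_)
  rw [Real.norm_of_nonneg (Real.exp_nonneg _), Real.exp_le_exp]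
  exact Finset.sum_le_sum fun i _ => mul_sub_mul_sq_le (hβ i) _ _

/-- Conditioning on finitely many noisy linear observations keeps a law Gaussian and does not
increase variances. -/
lemma tilted_sum_quadratic {ι : Type*} (μ : Measure E) [IsGaussian μ] (s : Finset ι)
    (x : ι → StrongDual ℝ E) (α : ι → ℝ) {β : ι → ℝ} (hβ : ∀ i, 0 < β i) :
    IsGaussian (μ.tilted fun e => ∑ i ∈ s, (α i * x i e - β i * x i e ^ 2)) ∧
      ∀ φ : StrongDual ℝ E,
        Var[φ; μ.tilted fun e => ∑ i ∈ s, (α i * x i e - β i * x i e ^ 2)] ≤ Var[φ; μ] := by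
  classical
  induction s using Finset.induction_on with
  | empty =>
    simp only [Finset.sum_empty, tilted_const]
    exact ⟨inferInstance, fun _ => le_rfl⟩
  | insert i s hi ih =>
    obtain ⟨hG, hV⟩ := ih
    have h : (fun e => ∑ j ∈ insert i s, (α j * x j e - β j * x j e ^ 2)) =
        (fun e => ∑ j ∈ s, (α j * x j e - β j * x j e ^ 2)) +
          fun e => α i * x i e - β i * x i e ^ 2 := by
      ext e; rw [Finset.sum_insert hi, Pi.add_apply, add_comm]
    rw [h, ← tilted_tilted (integrable_exp_sum_quadratic μ s x α hβ)]
    exact ⟨isGaussian_tilted_quadratic _ _ _ (hβ i), fun φ =>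
      (variance_tilted_quadratic_le _ _ _ (hβ i) φ).trans (hV φ)⟩

end

end HierBandit

namespace HierBandit

/-! ### The prior law of the environment -/

variable {d : ℕ}

lemma multivariateGaussian_eq_map_const_add (μ : Vec d) (S : Matrix (Fin d) (Fin d) ℝ) :
    multivariateGaussian μ S = (multivariateGaussian 0 S).map fun x => μ + x := by
  simp only [multivariateGaussian]
  rw [Measure.map_map (by fun_prop) (by fun_prop)]
  congr 1
  ext x : 1
  simp

lemma gaussKernel_apply (S : Matrix (Fin d) (Fin d) ℝ) (μ : Vec d) :
    gaussKernel S μ = multivariateGaussian μ S := rfl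

lemma piKernel_apply {ι α : Type*} [Fintype ι] {β : ι → Type*} [MeasurableSpace α]
    [∀ i, MeasurableSpace (β i)] (κ : ∀ i, Kernel α (β i)) [∀ i, IsMarkovKernel (κ i)] (a : α) :
    piKernel κ a = Measure.pi fun i => κ i a := rfl

instance isGaussian_pi {ι : Type*} [Fintype ι] {E : ι → Type*} [∀ i, NormedAddCommGroup (E i)]
    [∀ i, NormedSpace ℝ (E i)] [∀ i, MeasurableSpace (E i)] [∀ i, BorelSpace (E i)]
    [∀ i, SecondCountableTopology (E i)] [∀ i, CompleteSpace (E i)]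
    (μ : ∀ i, Measure (E i)) [∀ i, IsGaussian (μ i)] : IsGaussian (Measure.pi μ) := by
  have hind : iIndepFun (fun i (x : ∀ i, E i) => x i) (Measure.pi μ) :=
    iIndepFun_pi (X := fun _ x => x) fun i => aemeasurable_id
  have hlaw : ∀ i, HasGaussianLaw (fun x : ∀ i, E i => x i) (Measure.pi μ) := fun i => by
    constructor
    rw [(measurePreserving_eval μ i).map_eq]
    infer_instance
  have := (hind.hasGaussianLaw hlaw).isGaussian_map
  simpa using! this

/-- The law of `(μ_*, (θ_{s,*})_s)`. -/
def prior (m : ℕ) (μq : Vec d) (Sq S0 : Matrix (Fin d) (Fin d) ℝ) :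
    Measure (Vec d × (Fin m → Vec d)) :=
  multivariateGaussian μq Sq ⊗ₘ piKernel fun _ : Fin m => gaussKernel S0

variable {m : ℕ} (μq : Vec d) (Sq S0 : Matrix (Fin d) (Fin d) ℝ)

/-- The environment is a linear image of `μ_*` and the independent deviations `θ_{s,*} - μ_*`. -/
lemma prior_eq_map :
    prior m μq Sq S0 =
      ((multivariateGaussian μq Sq).prod
        (Measure.pi fun _ : Fin m => multivariateGaussian 0 S0)).map
      ((ContinuousLinearMap.fst ℝ (Vec d) (Fin m → Vec d)).prod
        (ContinuousLinearMap.pi fun s => ContinuousLinearMap.fst ℝ (Vec d) (Fin m → Vec d) +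
          (ContinuousLinearMap.proj s).comp
            (ContinuousLinearMap.snd ℝ (Vec d) (Fin m → Vec d)))) := by
  refine Measure.ext_of_lintegral _ fun f hf => ?_
  rw [prior, Measure.lintegral_compProd hf, lintegral_map hf (by fun_prop),
    lintegral_prod _ (by fun_prop)]
  refine lintegral_congr fun μ => ?_
  have h : piKernel (fun _ : Fin m => gaussKernel S0) μ =
      (Measure.pi fun _ : Fin m => multivariateGaussian 0 S0).map fun ξ s => μ + ξ s := by
    rw [piKernel_apply, Measure.pi_map_pi (f := fun _ x => μ + x) fun i => by fun_prop]
    simp_rw [gaussKernel_apply, ← multivariateGaussian_eq_map_const_add]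
  rw [h, lintegral_map (by fun_prop) (by fun_prop)]
  rfl

instance : IsGaussian (prior m μq Sq S0) := by
  rw [prior_eq_map]; infer_instance

variable {Sq S0}

lemma variance_inner_multivariateGaussian (μ : Vec d) {S : Matrix (Fin d) (Fin d) ℝ}
    (hS : S.PosSemidef) (u : Vec d) :
    Var[fun x => inner ℝ u x; multivariateGaussian μ S] = quadForm S u := by
  rw [← covarianceBilin_self IsGaussian.memLp_two_id, covarianceBilin_multivariateGaussian hS,
    quadForm]

lemma variance_inner_prior (hSq : Sq.PosSemidef) (hS0 : S0.PosSemidef) (s : Fin m) (u : Vec d) :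
    Var[fun e => inner ℝ u (e.2 s); prior m μq Sq S0] = quadForm Sq u + quadForm S0 u := by
  rw [prior_eq_map, variance_map (by fun_prop) (by fun_prop)]
  have hmem : ∀ (μ : Vec d) (S : Matrix (Fin d) (Fin d) ℝ),
      MemLp (fun x => inner ℝ u x) 2 (multivariateGaussian μ S) := fun μ S =>
    IsGaussian.memLp_dual _ (innerSL ℝ u) 2 (by simp)
  have hev := measurePreserving_eval (fun _ : Fin m => multivariateGaussian (0 : Vec d) S0) s
  have hY : MemLp (fun ξ : Fin m → Vec d => inner ℝ u (ξ s))
      2 (Measure.pi fun _ : Fin m => multivariateGaussian 0 S0) :=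
    (hmem 0 S0).comp_measurePreserving hev
  have hVY : Var[fun ξ : Fin m → Vec d => inner ℝ u (ξ s);
      Measure.pi fun _ : Fin m => multivariateGaussian 0 S0] = quadForm S0 u := by
    have h := variance_map (X := fun x : Vec d => inner ℝ u x)
      (μ := Measure.pi fun _ : Fin m => multivariateGaussian (0 : Vec d) S0) (by fun_prop)
      hev.measurable.aemeasurable
    rw [hev.map_eq, variance_inner_multivariateGaussian 0 hS0] at h
    exact h.symm
  have := variance_add_prod (hmem μq Sq) hY
  rw [hVY, variance_inner_multivariateGaussian _ hSq] at this
  rw [← this]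
  congr 1
  ext p
  simp [inner_add_right]

section Spectral
open scoped MatrixOrder

lemma bddAbove_spectrum {M : Matrix (Fin d) (Fin d) ℝ} : BddAbove (spectrum ℝ M) :=
  (Module.End.finite_spectrum (Matrix.toLin' M)).bddAbove |>.mono (by
    rw [Matrix.spectrum_toLin'])

lemma quadForm_le_maxEig {M : Matrix (Fin d) (Fin d) ℝ} (hM : M.IsHermitian) (u : Vec d) :
    quadForm M u ≤ maxEig M * ‖u‖ ^ 2 := by
  have h : M ≤ algebraMap ℝ _ (maxEig M) := by
    rw [le_algebraMap_iff_spectrum_le (ha := hM)]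
    exact fun x hx => le_csSup bddAbove_spectrum hx
  have h2 : 0 ≤ quadForm (algebraMap ℝ _ (maxEig M) - M) u := by
    have := (Matrix.le_iff.1 h).dotProduct_mulVec_nonneg u.ofLp
    rwa [star_trivial] at this
  have h3 : quadForm (algebraMap ℝ _ (maxEig M) - M) u = maxEig M * ‖u‖ ^ 2 - quadForm M u := by
    rw [quadForm, Matrix.sub_mulVec, dotProduct_sub, Algebra.algebraMap_eq_smul_one,
      Matrix.smul_mulVec, Matrix.one_mulVec, dotProduct_smul, ← quadForm, smul_eq_mul,
      EuclideanSpace.real_norm_sq_eq]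
    simp [dotProduct, sq]
  linarith

lemma spectrum_nonempty (hd : 0 < d) {M : Matrix (Fin d) (Fin d) ℝ} (hM : M.IsHermitian) :
    (spectrum ℝ M).Nonempty := by
  have : Nonempty (Fin d) := ⟨⟨0, hd⟩⟩
  rw [hM.spectrum_real_eq_range_eigenvalues]
  exact Set.range_nonempty _

lemma maxEig_nonneg {M : Matrix (Fin d) (Fin d) ℝ} (hM : M.PosSemidef) : 0 ≤ maxEig M := by
  refine Real.sSup_nonneg fun x hx => ?_
  rw [hM.1.spectrum_real_eq_range_eigenvalues] at hx
  obtain ⟨i, rfl⟩ := hx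
  exact hM.eigenvalues_nonneg i

lemma minEig_pos (hd : 0 < d) {M : Matrix (Fin d) (Fin d) ℝ} (hM : M.PosDef) : 0 < minEig M := by
  have hfin : (spectrum ℝ M).Finite := by
    rw [hM.1.spectrum_real_eq_range_eigenvalues]; exact Set.finite_range _
  have h := (spectrum_nonempty hd hM.1).csInf_mem hfin
  rw [minEig]
  rw [hM.1.spectrum_real_eq_range_eigenvalues] at h ⊢
  obtain ⟨i, hi⟩ := h
  rw [← hi]
  exact hM.eigenvalues_pos i

lemma minEig_le_maxEig (hd : 0 < d) {M : Matrix (Fin d) (Fin d) ℝ} (hM : M.IsHermitian) :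
    minEig M ≤ maxEig M := by
  have hfin : (spectrum ℝ M).Finite := by
    rw [hM.spectrum_real_eq_range_eigenvalues]; exact Set.finite_range _
  obtain ⟨x, hx⟩ := spectrum_nonempty hd hM
  exact (csInf_le hfin.bddBelow hx).trans (le_csSup hfin.bddAbove hx)

end Spectral

/-- The prior variances are at most `λ₁(Σ_q) + λ₁(Σ₀)`, which is at most `σ_max²` because
`λ₁(Σ₀) / λ_d(Σ₀) ≥ 1`. -/
lemma variance_inner_prior_le (hd : 0 < d) (hSq : Sq.PosSemidef) (hS0 : S0.PosDef) (s : Fin m)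
    (u : Vec d) :
    Var[fun e => inner ℝ u (e.2 s); prior m μq Sq S0] ≤ sigmaMax S0 Sq ^ 2 * ‖u‖ ^ 2 := by
  have h0 := maxEig_nonneg hS0.posSemidef
  have hq := maxEig_nonneg hSq
  have hmin := minEig_pos hd hS0
  have hle := minEig_le_maxEig hd hS0.1
  have hratio : maxEig Sq ≤ maxEig S0 ^ 2 * maxEig Sq / minEig S0 ^ 2 := by
    rw [le_div_iff₀ (by positivity), mul_comm]
    gcongr
  rw [variance_inner_prior μq hSq hS0.posSemidef, sigmaMax, Real.sq_sqrt (by positivity)]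
  calc quadForm Sq u + quadForm S0 u ≤ maxEig Sq * ‖u‖ ^ 2 + maxEig S0 * ‖u‖ ^ 2 :=
        add_le_add (quadForm_le_maxEig hSq.1 u) (quadForm_le_maxEig hS0.1 u)
    _ = (maxEig S0 + maxEig Sq) * ‖u‖ ^ 2 := by ring
    _ ≤ _ := by gcongr

end HierBandit

namespace HierBandit

/-! ### Products of measures with densities -/

section Pi

variable {ι : Type*} [Fintype ι] {β : ι → Type*} [∀ i, MeasurableSpace (β i)]
  (μ : ∀ i, Measure (β i)) [∀ i, IsProbabilityMeasure (μ i)]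

lemma lintegral_pi_prod {f : ∀ i, β i → ENNReal} (hf : ∀ i, Measurable (f i)) :
    ∫⁻ x, ∏ i, f i (x i) ∂(Measure.pi μ) = ∏ i, ∫⁻ x, f i x ∂(μ i) := by
  refine (lintegral_prod_eq_prod_lintegral_of_indepFun (μ := Measure.pi μ) Finset.univ
    (fun i (x : ∀ i, β i) => f i (x i)) (iIndepFun_pi fun i => (hf i).aemeasurable)
    fun i => by fun_prop).trans ?_
  refine Finset.prod_congr rfl fun i _ => ?_
  rw [← lintegral_map (f := f i) (hf i) (measurable_pi_apply i),
    (measurePreserving_eval μ i).map_eq]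

lemma pi_withDensity {f : ∀ i, β i → ENNReal} (hf : ∀ i, Measurable (f i))
    [∀ i, SigmaFinite ((μ i).withDensity (f i))] :
    Measure.pi (fun i => (μ i).withDensity (f i)) =
      (Measure.pi μ).withDensity fun x => ∏ i, f i (x i) := by
  refine Measure.pi_eq fun s hs => ?_
  have hS : MeasurableSet (Set.univ.pi s) := MeasurableSet.univ_pi hs
  rw [withDensity_apply _ hS, ← lintegral_indicator hS]
  have h : ∀ x, (Set.univ.pi s).indicator (fun x => ∏ i, f i (x i)) x =
      ∏ i, (s i).indicator (f i) (x i) := by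
    intro x
    by_cases hx : ∀ i, x i ∈ s i
    · rw [Set.indicator_of_mem (by simpa using hx)]
      exact Finset.prod_congr rfl fun i _ => by rw [Set.indicator_of_mem (hx i)]
    · rw [Set.indicator_of_notMem (by simpa using hx)]
      push Not at hx
      obtain ⟨i, hi⟩ := hx
      exact (Finset.prod_eq_zero (Finset.mem_univ i) (Set.indicator_of_notMem hi _)).symm
  simp_rw [h]
  rw [lintegral_pi_prod μ fun i => (hf i).indicator (hs i)]
  refine Finset.prod_congr rfl fun i _ => ?_
  rw [lintegral_indicator (hs i), withDensity_apply _ (hs i)]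

lemma pi_tilted {f : ∀ i, β i → ℝ} (hf : ∀ i, Measurable (f i))
    (hint : ∀ i, Integrable (fun x => Real.exp (f i x)) (μ i)) :
    Measure.pi (fun i => (μ i).tilted (f i)) = (Measure.pi μ).tilted fun x => ∑ i, f i (x i) := by
  have hprob : ∀ i, IsProbabilityMeasure ((μ i).tilted (f i)) := fun i =>
    isProbabilityMeasure_tilted (hint i)
  have hZ : ∫ x, Real.exp (∑ i, f i (x i)) ∂(Measure.pi μ) = ∏ i, ∫ x, Real.exp (f i x) ∂(μ i) := by
    simp_rw [Real.exp_sum]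
    exact integral_fintype_prod_eq_prod (𝕜 := ℝ) (fun i x => Real.exp (f i x))
  simp only [Measure.tilted] at hprob ⊢
  rw [pi_withDensity μ fun i => by fun_prop, hZ]
  congr 1
  ext x
  rw [Real.exp_sum, ← Finset.prod_div_distrib, ENNReal.ofReal_prod_of_nonneg fun i _ => ?_]
  exact div_nonneg (Real.exp_nonneg _) (integral_nonneg fun _ => Real.exp_nonneg _)

end Pi

/-! ### Conditional distributions -/

section CondDistrib

variable {Ω α β γ δ : Type*} [MeasurableSpace Ω] [MeasurableSpace α] [MeasurableSpace β]
  [MeasurableSpace γ] [MeasurableSpace δ] {P : Measure Ω}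

lemma _root_.ProbabilityTheory.HasCondDistrib.lintegral_eq [IsProbabilityMeasure P]
    {X : Ω → α} {Y : Ω → β} {κ : Kernel α β} [IsMarkovKernel κ]
    (h : HasCondDistrib Y X κ P) {f : α → β → ENNReal} (hf : Measurable (Function.uncurry f)) :
    ∫⁻ ω, f (X ω) (Y ω) ∂P = ∫⁻ ω, ∫⁻ y, f (X ω) y ∂(κ (X ω)) ∂P := by
  have h1 : ∫⁻ ω, f (X ω) (Y ω) ∂P = ∫⁻ p, Function.uncurry f p ∂(P.map fun ω => (X ω, Y ω)) := by
    rw [lintegral_map' hf.aemeasurable h.aemeasurable]; rfl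
  rw [h1, h.map_eq, Measure.lintegral_compProd hf,
    lintegral_map' (Measurable.lintegral_kernel_prod_right' hf).aemeasurable h.aemeasurable_fst]
  rfl

lemma _root_.ProbabilityTheory.HasCondDistrib.of_lintegral [IsProbabilityMeasure P]
    {X : Ω → α} {Y : Ω → β} {κ : Kernel α β} [IsMarkovKernel κ]
    (hX : Measurable X) (hY : Measurable Y)
    (h : ∀ f : α → β → ENNReal, Measurable (Function.uncurry f) →
      ∫⁻ ω, f (X ω) (Y ω) ∂P = ∫⁻ ω, ∫⁻ y, f (X ω) y ∂(κ (X ω)) ∂P) :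
    HasCondDistrib Y X κ P := by
  refine ⟨by fun_prop, Measure.ext_of_lintegral _ fun g hg => ?_⟩
  rw [lintegral_map hg (by fun_prop), Measure.lintegral_compProd hg,
    lintegral_map (Measurable.lintegral_kernel_prod_right' hg) hX]
  exact h (fun x y => g (x, y)) hg

lemma _root_.ProbabilityTheory.HasCondDistrib.compProd {X : Ω → α} {Y : Ω → β}
    {Z : Ω → γ} {κ : Kernel α β} [IsMarkovKernel κ] {η : Kernel (α × β) γ} [IsMarkovKernel η]
    (hY : HasCondDistrib Y X κ P) (hZ : HasCondDistrib Z (fun ω => (X ω, Y ω)) η P) :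
    HasCondDistrib (fun ω => (Y ω, Z ω)) X (κ ⊗ₖ η) P := by
  have hX := hY.aemeasurable_fst
  have hYm := hY.aemeasurable_snd
  have hZm := hZ.aemeasurable_snd
  refine ⟨by fun_prop, ?_⟩
  rw [← Measure.compProd_assoc', ← hY.map_eq, ← hZ.map_eq,
    AEMeasurable.map_map_of_aemeasurable (by fun_prop) (by fun_prop)]
  rfl

/-- If `Y` depends on `(W, H)` only through `H`, it depends on `(f W, H)` only through `H`. -/
lemma _root_.ProbabilityTheory.HasCondDistrib.coarsen [IsProbabilityMeasure P]
    {W : Ω → α} {H : Ω → β} {Y : Ω → γ} {κ : Kernel β γ}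
    [IsMarkovKernel κ] (h : HasCondDistrib Y (fun ω => (W ω, H ω)) (Kernel.prodMkLeft α κ) P)
    {f : α → δ} (hf : Measurable f) :
    HasCondDistrib Y (fun ω => (f (W ω), H ω)) (Kernel.prodMkLeft δ κ) P :=
  HasCondDistrib.comp_right (f := Prod.map f id) (hf := hf.prodMap measurable_id)
    (κ := Kernel.prodMkLeft δ κ) h

lemma _root_.ProbabilityTheory.HasCondDistrib.forget [IsProbabilityMeasure P]
    {W : Ω → α} {H : Ω → β} {Y : Ω → γ} {κ : Kernel β γ}
    [IsMarkovKernel κ] (h : HasCondDistrib Y (fun ω => (W ω, H ω)) (Kernel.prodMkLeft α κ) P) :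
    HasCondDistrib Y H κ P :=
  HasCondDistrib.comp_right (f := Prod.snd) (hf := measurable_snd) (κ := κ) h

/-- If `Y` is drawn from `κ` given `H`, and `Z` from `η` given `(H, Y)`, both without further
information on `W`, then `(Y, Z)` is drawn given `H` without further information on `W`. -/
lemma _root_.ProbabilityTheory.HasCondDistrib.compProd_prodMkLeft [IsProbabilityMeasure P]
    {W : Ω → α} {H : Ω → β} {Y : Ω → γ} {Z : Ω → δ}
    {κ : Kernel β γ} [IsMarkovKernel κ] {η : Kernel (β × γ) δ} [IsMarkovKernel η]
    (hY : HasCondDistrib Y (fun ω => (W ω, H ω)) (Kernel.prodMkLeft α κ) P)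
    (hZ : HasCondDistrib Z (fun ω => (W ω, (H ω, Y ω))) (Kernel.prodMkLeft α η) P) :
    HasCondDistrib (fun ω => (Y ω, Z ω)) (fun ω => (W ω, H ω))
      (Kernel.prodMkLeft α (κ ⊗ₖ η)) P := by
  have hZ' : HasCondDistrib Z (fun ω => ((W ω, H ω), Y ω))
      ((Kernel.prodMkLeft α η).comap MeasurableEquiv.prodAssoc MeasurableEquiv.prodAssoc.measurable)
      P := hZ.measurableEquiv_comp_right MeasurableEquiv.prodAssoc.symm
  have h := hY.compProd hZ'
  convert! h using 1
  ext p s hs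
  rw [Kernel.prodMkLeft_apply, Kernel.compProd_apply hs, Kernel.compProd_apply hs]
  rfl

/-- Conditional independence is symmetric: if `Z` depends on `(W, H)` only through `H`, then `W`
depends on `(Z, H)` only through `H`. -/
lemma _root_.ProbabilityTheory.HasCondDistrib.symm_prodMkLeft [IsProbabilityMeasure P]
    {W : Ω → α} {H : Ω → β} {Z : Ω → γ}
    {κ : Kernel β γ} [IsMarkovKernel κ] {C : Kernel β α} [IsMarkovKernel C]
    (hWm : Measurable W) (hHm : Measurable H) (hZm : Measurable Z)
    (hZ : HasCondDistrib Z (fun ω => (W ω, H ω)) (Kernel.prodMkLeft α κ) P)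
    (hW : HasCondDistrib W H C P) :
    HasCondDistrib W (fun ω => (Z ω, H ω)) (Kernel.prodMkLeft γ C) P := by
  refine HasCondDistrib.of_lintegral (by fun_prop) hWm fun f hf => ?_
  have hf' : Measurable fun q : (γ × β) × α => f q.1 q.2 := hf
  have hg : Measurable fun p : β × γ => ∫⁻ w, f (p.2, p.1) w ∂(C p.1) := by
    have h1 : Measurable fun q : (β × γ) × α => f (q.1.2, q.1.1) q.2 :=
      hf'.comp (f := fun q : (β × γ) × α => ((q.1.2, q.1.1), q.2)) (by fun_prop)
    exact h1.lintegral_kernel_prod_right' (κ := Kernel.prodMkRight γ C)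
  have hk : Measurable fun p : β × α => ∫⁻ z, f (z, p.1) p.2 ∂(κ p.1) := by
    have h1 : Measurable fun q : (β × α) × γ => f (q.2, q.1.1) q.1.2 :=
      hf'.comp (f := fun q : (β × α) × γ => ((q.2, q.1.1), q.1.2)) (by fun_prop)
    exact h1.lintegral_kernel_prod_right' (κ := Kernel.prodMkRight α κ)
  calc ∫⁻ ω, f (Z ω, H ω) (W ω) ∂P
      = ∫⁻ ω, ∫⁻ z, f (z, H ω) (W ω) ∂(κ (H ω)) ∂P := by
        have := hZ.lintegral_eq (f := fun (p : α × β) z => f (z, p.2) p.1)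
          (hf'.comp (f := fun q : (α × β) × γ => ((q.2, q.1.2), q.1.1)) (by fun_prop))
        exact this
    _ = ∫⁻ ω, ∫⁻ w, ∫⁻ z, f (z, H ω) w ∂(κ (H ω)) ∂(C (H ω)) ∂P :=
        hW.lintegral_eq (f := fun h w => ∫⁻ z, f (z, h) w ∂(κ h)) hk
    _ = ∫⁻ ω, ∫⁻ z, ∫⁻ w, f (z, H ω) w ∂(C (H ω)) ∂(κ (H ω)) ∂P := by
        refine lintegral_congr fun ω => lintegral_lintegral_swap ?_
        exact (hf'.comp (f := fun q : α × γ => ((q.2, H ω), q.1)) (by fun_prop)).aemeasurable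
    _ = ∫⁻ ω, ∫⁻ w, f (Z ω, H ω) w ∂(C (H ω)) ∂P :=
        (hZ.forget.lintegral_eq (f := fun h z => ∫⁻ w, f (z, h) w ∂(C h)) hg).symm

end CondDistrib

/-! ### Bayes' rule -/

section Bayes

variable {Ω α β : Type*} [MeasurableSpace Ω] [MeasurableSpace α] [MeasurableSpace β]

/-- The posterior kernel `a ↦ (κ a).tilted (F a)` for the prior `κ` and log-likelihood `F`. -/
def tiltedKernel (κ : Kernel α β) [IsMarkovKernel κ] (F : α → β → ℝ) : Kernel α β :=
  κ.withDensity fun a b => ENNReal.ofReal (Real.exp (F a b) / ∫ b, Real.exp (F a b) ∂(κ a))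

variable (κ : Kernel α β) [IsMarkovKernel κ] {F : α → β → ℝ}

lemma tiltedKernel_apply (hF : Measurable (Function.uncurry F)) (a : α) :
    tiltedKernel κ F a = (κ a).tilted (F a) := by
  have h1 : Measurable fun p : α × β => Real.exp (F p.1 p.2) := Real.measurable_exp.comp hF
  have h2 : Measurable fun a => ∫ b, Real.exp (F a b) ∂(κ a) :=
    (h1.stronglyMeasurable.integral_kernel_prod_right' (κ := κ)).measurable
  rw [tiltedKernel, Kernel.withDensity_apply]
  · rfl
  · exact ENNReal.measurable_ofReal.comp (h1.div (h2.comp measurable_fst))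

lemma isMarkovKernel_tiltedKernel (hF : Measurable (Function.uncurry F))
    (hint : ∀ a, Integrable (fun b => Real.exp (F a b)) (κ a)) :
    IsMarkovKernel (tiltedKernel κ F) :=
  ⟨fun a => by rw [tiltedKernel_apply κ hF]; exact isProbabilityMeasure_tilted (hint a)⟩

/-- Bayes' rule: if `(A, B)` has density `exp (F a b)` with respect to `ν ⊗ₘ κ`, the conditional law
of `B` given `A = a` is `κ a` tilted by `F a`. -/
lemma hasCondDistrib_tiltedKernel {P : Measure Ω} [IsProbabilityMeasure P] {A : Ω → α} {B : Ω → β}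
    (hA : Measurable A) (hB : Measurable B) {ν : Measure α} [SFinite ν]
    (hF : Measurable (Function.uncurry F))
    (hint : ∀ a, Integrable (fun b => Real.exp (F a b)) (κ a))
    (hlaw : ∀ f : α → β → ENNReal, Measurable (Function.uncurry f) →
      ∫⁻ ω, f (A ω) (B ω) ∂P =
        ∫⁻ a, ∫⁻ b, ENNReal.ofReal (Real.exp (F a b)) * f a b ∂(κ a) ∂ν) :
    HasCondDistrib B A (tiltedKernel κ F) P := by
  have hmk := isMarkovKernel_tiltedKernel κ hF hint
  refine HasCondDistrib.of_lintegral hA hB fun f hf => ?_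
  have hexp : ∀ a, Measurable fun b => ENNReal.ofReal (Real.exp (F a b)) := fun a =>
    ENNReal.measurable_ofReal.comp (Real.measurable_exp.comp (hF.comp measurable_prodMk_left))
  have hfa : ∀ a, Measurable (f a) := fun a => hf.comp measurable_prodMk_left
  have hg : Measurable fun a => ∫⁻ y, f a y ∂(tiltedKernel κ F a) :=
    hf.lintegral_kernel_prod_right'
  rw [hlaw f hf, hlaw (fun a _ => ∫⁻ y, f a y ∂(tiltedKernel κ F a)) (hg.comp measurable_fst)]
  refine lintegral_congr fun a => ?_
  have hZ := integral_exp_pos (hint a)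
  rw [lintegral_mul_const _ (hexp a), tiltedKernel_apply κ hF, lintegral_tilted,
    ← ofReal_integral_eq_lintegral_ofReal (hint a) (ae_of_all _ fun b => Real.exp_nonneg _),
    ← lintegral_const_mul]
  · refine lintegral_congr fun b => ?_
    rw [← mul_assoc, ← ENNReal.ofReal_mul hZ.le]
    congr 2
    field_simp
  · have := hfa a
    have h2 : Measurable (F a) := hF.comp measurable_prodMk_left
    fun_prop

end Bayes

end HierBandit

namespace HierBandit

/-! ### The likelihood of a history -/

variable {d m : ℕ}

/-- The log-likelihood ratio of an entry of a task history: for an action `a` with reward `y`, the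
logarithm of the density at `y` of `N(aᵀ θ, σ²)` with respect to `N(0, σ²)`; zero if the agent did
not act. -/
def entryLL (σ : ℝ) (θ : Vec d) (e : Bool × Vec d × ℝ) : ℝ :=
  if e.1 = true then (inner ℝ e.2.1 θ * e.2.2 - inner ℝ e.2.1 θ ^ 2 / 2) / σ ^ 2 else 0

/-- The log-likelihood of the history of one task. -/
def taskLL (σ : ℝ) {t : ℕ} (θ : Vec d) (h : TaskHist d t) : ℝ := ∑ ℓ, entryLL σ θ (h ℓ)

/-- The log-likelihood of the histories of all tasks. -/
def histLL (σ : ℝ) {t : ℕ} (θ : Fin m → Vec d) (h : Hist d m t) : ℝ := ∑ s, taskLL σ (θ s) (h s)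

/-- The entry added to the history of task `s` when the tasks `q.1` are acted in with the actions
`q.2`, and the reward in task `s` is `y`. -/
def mkEntry (q : Finset (Fin m) × (Fin m → Vec d)) (s : Fin m) (y : ℝ) : Bool × Vec d × ℝ :=
  if s ∈ q.1 then (true, q.2 s, y) else (false, 0, 0)

/-- The history after one more round. -/
def histSnoc {t : ℕ} (h : Hist d m t) (q : Finset (Fin m) × (Fin m → Vec d)) (y : Fin m → ℝ) :
    Hist d m (t + 1) :=
  fun s => Fin.snoc (α := fun _ => Bool × Vec d × ℝ) (h s) (mkEntry q s (y s))

section Measurability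

@[fun_prop]
lemma measurable_entryLL (σ : ℝ) :
    Measurable fun p : Vec d × (Bool × Vec d × ℝ) => entryLL σ p.1 p.2 := by
  unfold entryLL
  refine Measurable.ite ?_ (by fun_prop) (by fun_prop)
  exact (measurable_snd.fst : Measurable fun p : Vec d × (Bool × Vec d × ℝ) => p.2.1)
    (measurableSet_singleton true)

@[fun_prop]
lemma measurable_taskLL (σ : ℝ) {t : ℕ} :
    Measurable fun p : Vec d × TaskHist d t => taskLL σ p.1 p.2 := by
  unfold taskLL
  refine Finset.measurable_sum _ fun ℓ _ => ?_
  exact (measurable_entryLL σ).comp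
    (f := fun p : Vec d × TaskHist d t => (p.1, p.2 ℓ)) (by fun_prop)

@[fun_prop]
lemma measurable_histLL (σ : ℝ) {t : ℕ} :
    Measurable fun p : (Fin m → Vec d) × Hist d m t => histLL σ p.1 p.2 := by
  unfold histLL
  refine Finset.measurable_sum _ fun s _ => ?_
  exact (measurable_taskLL σ).comp
    (f := fun p : (Fin m → Vec d) × Hist d m t => (p.1 s, p.2 s)) (by fun_prop)

@[fun_prop]
lemma measurable_mkEntry (s : Fin m) :
    Measurable fun p : (Finset (Fin m) × (Fin m → Vec d)) × ℝ => mkEntry p.1 s p.2 := by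
  unfold mkEntry
  refine Measurable.ite ?_ (by fun_prop) (by fun_prop)
  exact (measurable_fst.fst : Measurable fun p : (Finset (Fin m) × (Fin m → Vec d)) × ℝ => p.1.1)
    (measurableSet_mem_finset s)

@[fun_prop]
lemma measurable_histSnoc {t : ℕ} :
    Measurable fun p : Hist d m t × ((Finset (Fin m) × (Fin m → Vec d)) × (Fin m → ℝ)) =>
      histSnoc p.1 p.2.1 p.2.2 := by
  refine measurable_pi_lambda _ fun s => measurable_pi_lambda _ fun ℓ => ?_
  refine Fin.lastCases ?_ (fun i => ?_) ℓ
  · simp only [histSnoc, Fin.snoc_last]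
    exact (measurable_mkEntry s).comp
      (f := fun p : Hist d m t × ((Finset (Fin m) × (Fin m → Vec d)) × (Fin m → ℝ)) =>
        (p.2.1, p.2.2 s)) (by fun_prop)
  · simp only [histSnoc, Fin.snoc_castSucc]
    fun_prop

end Measurability

lemma histLL_histSnoc (σ : ℝ) {t : ℕ} (θ : Fin m → Vec d) (h : Hist d m t)
    (q : Finset (Fin m) × (Fin m → Vec d)) (y : Fin m → ℝ) :
    histLL σ θ (histSnoc h q y) = histLL σ θ h + ∑ s, entryLL σ (θ s) (mkEntry q s (y s)) := by
  simp only [histLL, taskLL, histSnoc, Fin.sum_univ_castSucc, Fin.snoc_castSucc, Fin.snoc_last,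
    Finset.sum_add_distrib]

/-- The linear functional `θ ↦ aᵀ θ` observed in an entry of a task history; zero if the agent did
not act. -/
def entryDual (e : Bool × Vec d × ℝ) : StrongDual ℝ (Vec d) :=
  if e.1 = true then innerSL ℝ e.2.1 else 0

/-- The log-likelihood is a concave quadratic function of the parameter. -/
lemma entryLL_eq_entryDual (σ : ℝ) (θ : Vec d) (e : Bool × Vec d × ℝ) :
    entryLL σ θ e = e.2.2 / σ ^ 2 * entryDual e θ - 1 / (2 * σ ^ 2) * entryDual e θ ^ 2 := by
  unfold entryLL entryDual
  split_ifs
  · rw [innerSL_apply_apply]; ring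
  · simp

lemma lintegral_gaussianReal_eq {σ : ℝ} (hσ : 0 < σ) (x : ℝ) {f : ℝ → ENNReal}
    (hf : Measurable f) :
    ∫⁻ y, f y ∂(gaussianReal x (σ ^ 2).toNNReal) =
      ∫⁻ y, ENNReal.ofReal (Real.exp ((x * y - x ^ 2 / 2) / σ ^ 2)) * f y
        ∂(gaussianReal 0 (σ ^ 2).toNNReal) := by
  have hv : (σ ^ 2).toNNReal ≠ 0 := by simpa using hσ.ne'
  have hc : ((σ ^ 2).toNNReal : ℝ) = σ ^ 2 := Real.coe_toNNReal _ (sq_nonneg σ)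
  rw [gaussianReal_of_var_ne_zero _ hv, gaussianReal_of_var_ne_zero _ hv,
    lintegral_withDensity_eq_lintegral_mul _ (measurable_gaussianPDF _ _) hf,
    lintegral_withDensity_eq_lintegral_mul _ (measurable_gaussianPDF _ _) (by fun_prop)]
  refine lintegral_congr fun y => ?_
  simp only [Pi.mul_apply, gaussianPDF]
  rw [← mul_assoc, ← ENNReal.ofReal_mul (gaussianPDFReal_nonneg _ _ _)]
  congr 2
  simp only [gaussianPDFReal, hc]
  rw [mul_assoc (√(2 * Real.pi * σ ^ 2))⁻¹, ← Real.exp_add]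
  congr 2
  field_simp
  ring

/-- The law of the new entries of the histories under the parameters `θ` has the density given by
the likelihood with respect to the law for which all the rewards have mean zero. -/
lemma lintegral_mkEntry {σ : ℝ} (hσ : 0 < σ) (θ : Fin m → Vec d)
    (q : Finset (Fin m) × (Fin m → Vec d)) {f : (Fin m → Bool × Vec d × ℝ) → ENNReal}
    (hf : Measurable f) :
    ∫⁻ y, f (fun s => mkEntry q s (y s))
        ∂(Measure.pi fun s => gaussianReal (inner ℝ (q.2 s) (θ s)) (σ ^ 2).toNNReal) =
      ∫⁻ y, ENNReal.ofReal (Real.exp (∑ s, entryLL σ (θ s) (mkEntry q s (y s)))) *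
        f (fun s => mkEntry q s (y s)) ∂(Measure.pi fun _ => gaussianReal 0 (σ ^ 2).toNNReal) := by
  have hmk : ∀ s, Measurable (mkEntry q s) := fun s =>
    (measurable_mkEntry s).comp measurable_prodMk_left
  have hLL : ∀ s, Measurable fun e => ENNReal.ofReal (Real.exp (entryLL σ (θ s) e)) := fun s =>
    ENNReal.measurable_ofReal.comp (Real.measurable_exp.comp
      ((measurable_entryLL σ).comp measurable_prodMk_left))
  have h1 : ∀ s, (gaussianReal (inner ℝ (q.2 s) (θ s)) (σ ^ 2).toNNReal).map (mkEntry q s) =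
      ((gaussianReal 0 (σ ^ 2).toNNReal).map (mkEntry q s)).withDensity
        fun e => ENNReal.ofReal (Real.exp (entryLL σ (θ s) e)) := by
    intro s
    refine Measure.ext_of_lintegral _ fun g hg => ?_
    rw [lintegral_withDensity_eq_lintegral_mul _ (hLL s) hg, lintegral_map hg (hmk s),
      lintegral_map ((hLL s).mul hg) (hmk s)]
    by_cases hs : s ∈ q.1
    · rw [lintegral_gaussianReal_eq hσ (f := fun a => g (mkEntry q s a)) _ (hg.comp (hmk s))]
      simp [mkEntry, hs, entryLL]
    · simp [mkEntry, hs, entryLL]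
  have hprob : ∀ s, IsProbabilityMeasure ((gaussianReal 0 (σ ^ 2).toNNReal).map (mkEntry q s)) :=
    fun s => Measure.isProbabilityMeasure_map (hmk s).aemeasurable
  have hprob' : ∀ s, IsProbabilityMeasure
      (((gaussianReal 0 (σ ^ 2).toNNReal).map (mkEntry q s)).withDensity
        fun e => ENNReal.ofReal (Real.exp (entryLL σ (θ s) e))) := fun s => by
    rw [← h1 s]; exact Measure.isProbabilityMeasure_map (hmk s).aemeasurable
  have hmap : Measurable fun y : Fin m → ℝ => fun s => mkEntry q s (y s) := by fun_prop
  have hm1 := Measure.pi_map_pi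
    (μ := fun s => gaussianReal (inner ℝ (q.2 s) (θ s)) (σ ^ 2).toNNReal)
    (f := fun s => mkEntry q s) fun s => (hmk s).aemeasurable
  have hm0 := Measure.pi_map_pi
    (μ := fun _ : Fin m => gaussianReal 0 (σ ^ 2).toNNReal)
    (f := fun s => mkEntry q s) fun s => (hmk s).aemeasurable
  have hprod : Measurable fun e : Fin m → Bool × Vec d × ℝ =>
      ∏ s, ENNReal.ofReal (Real.exp (entryLL σ (θ s) (e s))) :=
    Finset.measurable_prod _ fun s _ => (hLL s).comp (measurable_pi_apply s)
  rw [← lintegral_map hf hmap, hm1]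
  simp_rw [h1]
  rw [pi_withDensity _ hLL, ← hm0, lintegral_withDensity_eq_lintegral_mul _ hprod hf,
    lintegral_map (hprod.mul hf) hmap]
  refine lintegral_congr fun y => ?_
  rw [Pi.mul_apply, Real.exp_sum, ENNReal.ofReal_prod_of_nonneg fun s _ => Real.exp_nonneg _]

end HierBandit

namespace HierBandit

namespace Interaction

/-! ### The joint law of environment and history -/

lemma hist_succ {Ω : Type*} {d m : ℕ} {X : Interaction Ω d m} {sel : Vec d → Vec d}
    (t : ℕ) (ω : Ω) :
    X.hist sel (t + 1) ω =
      histSnoc (X.hist sel t ω) (X.tasks t ω, fun s => X.action sel s t ω)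
        fun s => X.reward s t ω := by
  funext s ℓ
  refine Fin.lastCases ?_ (fun i => ?_) ℓ
  · simp [hist, taskHist, histSnoc, mkEntry]
  · simp [hist, taskHist, histSnoc]

variable {Ω : Type*} {d m n : ℕ} {X : Interaction Ω d m} {sel : Vec d → Vec d}
  [MeasurableSpace Ω] {P : Measure Ω} [IsProbabilityMeasure P]
  {μq : Vec d} {Sq S0 : Matrix (Fin d) (Fin d) ℝ} {σ : ℝ}

instance (t : ℕ) : IsMarkovKernel (X.hyperPosterior sel P t) := by
  unfold hyperPosterior; infer_instance

instance (s : Fin m) (t : ℕ) : IsMarkovKernel (X.condPosterior sel P s t) := by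
  unfold condPosterior; infer_instance

instance (t : ℕ) : IsMarkovKernel (X.sampleKernel sel P t) := by
  unfold sampleKernel; infer_instance

namespace IsHierTS

lemma measurableSet_mem_tasks (hX : X.IsHierTS sel P μq Sq S0 σ n) (s : Fin m) (t : ℕ) :
    MeasurableSet {ω | s ∈ X.tasks t ω} :=
  hX.measurable_tasks t (measurableSet_mem_finset s)

lemma measurable_action (hX : X.IsHierTS sel P μq Sq S0 σ n) (hsel : Measurable sel) (s : Fin m)
    (t : ℕ) : Measurable (X.action sel s t) :=
  hsel.comp (hX.measurable_thetaSample s t)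

lemma measurable_taskHist (hX : X.IsHierTS sel P μq Sq S0 σ n) (hsel : Measurable sel) (s : Fin m)
    (t : ℕ) : Measurable (X.taskHist sel s t) :=
  measurable_pi_lambda _ fun ℓ => Measurable.ite (hX.measurableSet_mem_tasks s ℓ)
    (measurable_const.prodMk ((hX.measurable_action hsel s ℓ).prodMk (hX.measurable_reward s ℓ)))
    measurable_const

lemma measurable_hist (hX : X.IsHierTS sel P μq Sq S0 σ n) (hsel : Measurable sel) (t : ℕ) :
    Measurable (X.hist sel t) :=
  measurable_pi_lambda _ fun s => hX.measurable_taskHist hsel s t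

lemma measurable_env (hX : X.IsHierTS sel P μq Sq S0 σ n) : Measurable X.env :=
  hX.measurable_muStar.prodMk (measurable_pi_lambda _ hX.measurable_thetaStar)

lemma hasLaw_env (hX : X.IsHierTS sel P μq Sq S0 σ n) : HasLaw X.env (prior m μq Sq S0) P :=
  hX.muStar_law.prodMk_of_hasCondDistrib hX.thetaStar_law

end IsHierTS

/-- The law of `(θ_{s,t})_s` given `H_t`: the hyper-posterior mixture of the conditional laws given
`μ_t`. -/
def sampleLaw (X : Interaction Ω d m) (sel : Vec d → Vec d) (P : Measure Ω)
    [IsProbabilityMeasure P] (t : ℕ) : Kernel (Hist d m t) (Fin m → Vec d) :=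
  (X.hyperPosterior sel P t ⊗ₖ X.sampleKernel sel P t).snd

instance (t : ℕ) : IsMarkovKernel (X.sampleLaw sel P t) := by
  unfold sampleLaw; infer_instance

namespace IsHierTS

lemma thetaSample_sampleLaw (hX : X.IsHierTS sel P μq Sq S0 σ n) (t : ℕ) :
    HasCondDistrib (fun ω s => X.thetaSample s t ω)
      (fun ω => ((X.env ω, X.tasks t ω), X.hist sel t ω))
      (Kernel.prodMkLeft _ (X.sampleLaw sel P t)) P :=
  ((hX.muSample_law t).compProd_prodMkLeft (hX.thetaSample_law t)).snd

/-- The tasks and the actions of round `t` depend on the environment only through `H_t`. -/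
lemma exists_tasks_action_law (hX : X.IsHierTS sel P μq Sq S0 σ n) (hsel : Measurable sel)
    (t : ℕ) :
    ∃ K : Kernel (Hist d m t) (Finset (Fin m) × (Fin m → Vec d)), IsMarkovKernel K ∧
      HasCondDistrib (fun ω => (X.tasks t ω, fun s => X.action sel s t ω))
        (fun ω => (X.env ω, X.hist sel t ω)) (Kernel.prodMkLeft _ K) P := by
  obtain ⟨ν, hν, hlaw⟩ := hX.tasks_law t
  have hsel' : Measurable fun (θ : Fin m → Vec d) s => sel (θ s) := by fun_prop
  have h1 : HasCondDistrib (fun ω s => X.action sel s t ω)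
      (fun ω => ((X.env ω, X.tasks t ω), X.hist sel t ω))
      (Kernel.prodMkLeft _ ((X.sampleLaw sel P t).map fun θ s => sel (θ s))) P := by
    have h := (hX.thetaSample_sampleLaw t).comp_left hsel'
    convert! h using 1
    ext p s hs
    rw [Kernel.prodMkLeft_apply, Kernel.map_apply _ hsel', Kernel.map_apply _ hsel',
      Kernel.prodMkLeft_apply]
  have hmk : IsMarkovKernel ((X.sampleLaw sel P t).map fun θ s => sel (θ s)) :=
    Kernel.IsMarkovKernel.map _ hsel'
  have h2 : HasCondDistrib (fun ω s => X.action sel s t ω)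
      (fun ω => (X.env ω, (X.hist sel t ω, X.tasks t ω)))
      (Kernel.prodMkLeft _ (Kernel.prodMkRight _
        ((X.sampleLaw sel P t).map fun θ s => sel (θ s)))) P := by
    exact HasCondDistrib.comp_right (Z := fun ω => ((X.env ω, X.tasks t ω), X.hist sel t ω))
      (f := fun p => (p.1.1, (p.2, p.1.2))) (hf := by fun_prop)
      (κ := Kernel.prodMkLeft _ (Kernel.prodMkRight _
        ((X.sampleLaw sel P t).map fun θ s => sel (θ s)))) h1
  exact ⟨_, inferInstance, hlaw.compProd_prodMkLeft h2⟩

set_option maxHeartbeats 400000 in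
/-- The law of `(μ_*, (θ_{s,*})_s, H_t)` has the likelihood as its density with respect to the
product of the prior and a reference measure: the law of the history if all rewards had mean
zero. -/
lemma exists_joint_law (hX : X.IsHierTS sel P μq Sq S0 σ n) (hsel : Measurable sel) (hσ : 0 < σ)
    (t : ℕ) :
    ∃ ρ : Measure (Hist d m t), IsProbabilityMeasure ρ ∧
      ∀ f : Hist d m t → (Vec d × (Fin m → Vec d)) → ENNReal, Measurable (Function.uncurry f) →
        ∫⁻ ω, f (X.hist sel t ω) (X.env ω) ∂P =
          ∫⁻ h, ∫⁻ e, ENNReal.ofReal (Real.exp (histLL σ e.2 h)) * f h e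
            ∂(prior m μq Sq S0) ∂ρ := by
  induction t with
  | zero =>
    refine ⟨Measure.dirac fun _ => Fin.elim0, inferInstance, fun f hf => ?_⟩
    have h0 : ∀ ω, X.hist sel 0 ω = fun _ => Fin.elim0 := fun ω => by
      funext s ℓ; exact ℓ.elim0
    have hL : ∀ (θ : Fin m → Vec d) (h : Hist d m 0), histLL σ θ h = 0 := fun θ h => by
      simp [histLL, taskLL]
    have hmeas : Measurable fun h : Hist d m 0 => ∫⁻ e, f h e ∂(prior m μq Sq S0) :=
      hf.lintegral_prod_right'
    simp_rw [h0, hL, Real.exp_zero, ENNReal.ofReal_one, one_mul]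
    rw [lintegral_dirac' _ hmeas, ← hX.hasLaw_env.map_eq,
      lintegral_map (f := fun e => f (fun _ => Fin.elim0) e) (hf.comp measurable_prodMk_left)
        hX.measurable_env]
  | succ t ih =>
    obtain ⟨ρ, hρ, hlaw⟩ := ih
    obtain ⟨K, hK, hKlaw⟩ := hX.exists_tasks_action_law hsel t
    set G : Measure (Fin m → ℝ) := Measure.pi fun _ => gaussianReal 0 (σ ^ 2).toNNReal with hG
    set K' : Kernel (Hist d m t) ((Finset (Fin m) × (Fin m → Vec d)) × (Fin m → ℝ)) :=
      K ×ₖ Kernel.const _ G with hK'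
    have hlK' : ∀ h (g : (Finset (Fin m) × (Fin m → Vec d)) × (Fin m → ℝ) → ENNReal),
        Measurable g → ∫⁻ p, g p ∂(K' h) = ∫⁻ q, ∫⁻ y, g (q, y) ∂G ∂(K h) := by
      intro h g hg
      rw [hK', Kernel.prod_apply, Kernel.const_apply, lintegral_prod _ hg.aemeasurable]
    have hsnoc : Measurable fun p : Hist d m t ×
        ((Finset (Fin m) × (Fin m → Vec d)) × (Fin m → ℝ)) => histSnoc p.1 p.2.1 p.2.2 :=
      measurable_histSnoc
    refine ⟨(ρ ⊗ₘ K').map fun p => histSnoc p.1 p.2.1 p.2.2,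
      Measure.isProbabilityMeasure_map hsnoc.aemeasurable, fun f hf => ?_⟩
    have hf' : Measurable fun p : Hist d m (t + 1) × (Vec d × (Fin m → Vec d)) => f p.1 p.2 := hf
    -- the factor that the new entries contribute to the likelihood
    set L : (Fin m → Vec d) → ((Finset (Fin m) × (Fin m → Vec d)) × (Fin m → ℝ)) → ENNReal :=
      fun θ p => ENNReal.ofReal (Real.exp (∑ s, entryLL σ (θ s) (mkEntry p.1 s (p.2 s)))) with hL
    have hLm : Measurable fun p : (Fin m → Vec d) ×
        ((Finset (Fin m) × (Fin m → Vec d)) × (Fin m → ℝ)) => L p.1 p.2 := by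
      refine ENNReal.measurable_ofReal.comp (Real.measurable_exp.comp ?_)
      refine Finset.measurable_sum _ fun s _ => ?_
      exact (measurable_entryLL σ).comp
        (f := fun p : (Fin m → Vec d) × ((Finset (Fin m) × (Fin m → Vec d)) × (Fin m → ℝ)) =>
          (p.1 s, mkEntry p.2.1 s (p.2.2 s))) (by fun_prop)
    set F : Hist d m t → (Vec d × (Fin m → Vec d)) →
        ((Finset (Fin m) × (Fin m → Vec d)) × (Fin m → ℝ)) → ENNReal :=
      fun h e p => L e.2 p * f (histSnoc h p.1 p.2) e with hF
    have hFm : Measurable fun x : (Hist d m t × (Vec d × (Fin m → Vec d))) ×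
        ((Finset (Fin m) × (Fin m → Vec d)) × (Fin m → ℝ)) => F x.1.1 x.1.2 x.2 := by
      refine (hLm.comp (f := fun x : (Hist d m t × (Vec d × (Fin m → Vec d))) ×
        ((Finset (Fin m) × (Fin m → Vec d)) × (Fin m → ℝ)) => (x.1.2.2, x.2))
        (by fun_prop)).mul ?_
      exact hf'.comp (f := fun x : (Hist d m t × (Vec d × (Fin m → Vec d))) ×
        ((Finset (Fin m) × (Fin m → Vec d)) × (Fin m → ℝ)) =>
          (histSnoc x.1.1 x.2.1 x.2.2, x.1.2)) (by fun_prop)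
    have hhist := hX.measurable_hist hsel t
    have step1 : ∫⁻ ω, f (X.hist sel (t + 1) ω) (X.env ω) ∂P =
        ∫⁻ ω, ∫⁻ y, F (X.hist sel t ω) (X.env ω)
          ((X.tasks t ω, fun s => X.action sel s t ω), y) ∂G ∂P := by
      simp_rw [hist_succ]
      have h := (hX.reward_law t).lintegral_eq
        (f := fun (x : (Vec d × Finset (Fin m) × Hist d m t) × (Fin m → Vec d × Vec d)) y =>
          f (histSnoc x.1.2.2 (x.1.2.1, fun s => (x.2 s).2) y) (x.1.1, fun s => (x.2 s).1))
        (hf'.comp (f := fun x : ((Vec d × Finset (Fin m) × Hist d m t) ×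
          (Fin m → Vec d × Vec d)) × (Fin m → ℝ) =>
            (histSnoc x.1.1.2.2 (x.1.1.2.1, fun s => (x.1.2 s).2) x.2,
              (x.1.1.1, fun s => (x.1.2 s).1))) (by fun_prop))
      refine h.trans (lintegral_congr fun ω => ?_)
      have hfω : Measurable fun E : Fin m → Bool × Vec d × ℝ =>
          f (fun s => Fin.snoc (α := fun _ => Bool × Vec d × ℝ) (X.hist sel t ω s) (E s))
            (X.env ω) := by
        refine hf'.comp (f := fun E : Fin m → Bool × Vec d × ℝ =>
          ((fun s => Fin.snoc (α := fun _ => Bool × Vec d × ℝ) (X.hist sel t ω s) (E s) :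
            Hist d m (t + 1)), X.env ω)) (Measurable.prodMk ?_ measurable_const)
        refine measurable_pi_lambda _ fun s => measurable_pi_lambda _ fun ℓ => ?_
        refine Fin.lastCases ?_ (fun i => ?_) ℓ
        · simp only [Fin.snoc_last]; fun_prop
        · simp only [Fin.snoc_castSucc]; fun_prop
      exact lintegral_mkEntry hσ (fun s => X.thetaStar s ω)
        (X.tasks t ω, fun s => X.action sel s t ω) hfω
    clear_value F
    have hF2 : ∀ h e, Measurable (F h e) := fun h e =>
      hFm.comp (measurable_prodMk_left (x := (h, e)))
    have step2 : ∫⁻ ω, ∫⁻ y, F (X.hist sel t ω) (X.env ω)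
          ((X.tasks t ω, fun s => X.action sel s t ω), y) ∂G ∂P =
        ∫⁻ ω, ∫⁻ p, F (X.hist sel t ω) (X.env ω) p ∂(K' (X.hist sel t ω)) ∂P := by
      have hm : Measurable fun x : ((Vec d × (Fin m → Vec d)) × Hist d m t) ×
          (Finset (Fin m) × (Fin m → Vec d)) => ∫⁻ y, F x.1.2 x.1.1 (x.2, y) ∂G := by
        have : Measurable fun z : (((Vec d × (Fin m → Vec d)) × Hist d m t) ×
            (Finset (Fin m) × (Fin m → Vec d))) × (Fin m → ℝ) =>
            F z.1.1.2 z.1.1.1 (z.1.2, z.2) :=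
          hFm.comp (f := fun z : (((Vec d × (Fin m → Vec d)) × Hist d m t) ×
            (Finset (Fin m) × (Fin m → Vec d))) × (Fin m → ℝ) =>
            ((z.1.1.2, z.1.1.1), (z.1.2, z.2))) (by fun_prop)
        exact this.lintegral_prod_right'
      have h := hKlaw.lintegral_eq (f := fun (x : (Vec d × (Fin m → Vec d)) × Hist d m t) q =>
        ∫⁻ y, F x.2 x.1 (q, y) ∂G) hm
      rw [h]
      refine lintegral_congr fun ω => ?_
      rw [hlK' _ _ (hF2 _ _)]
      rfl
    have hm3 : Measurable fun x : Hist d m t × (Vec d × (Fin m → Vec d)) =>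
        ∫⁻ p, F x.1 x.2 p ∂(K' x.1) :=
      hFm.lintegral_kernel_prod_right' (κ := Kernel.prodMkRight _ K')
    have hLL : Measurable fun x : Hist d m (t + 1) × (Vec d × (Fin m → Vec d)) =>
        ENNReal.ofReal (Real.exp (histLL σ x.2.2 x.1)) * f x.1 x.2 :=
      (ENNReal.measurable_ofReal.comp (Real.measurable_exp.comp ((measurable_histLL σ).comp
        (f := fun x : Hist d m (t + 1) × (Vec d × (Fin m → Vec d)) => (x.2.2, x.1))
          (by fun_prop)))).mul hf'
    have hm4 : Measurable fun h : Hist d m (t + 1) =>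
        ∫⁻ e, ENNReal.ofReal (Real.exp (histLL σ e.2 h)) * f h e ∂(prior m μq Sq S0) :=
      hLL.lintegral_prod_right'
    rw [step1, step2, hlaw (fun h e => ∫⁻ p, F h e p ∂(K' h)) hm3, lintegral_map hm4 hsnoc]
    refine Eq.trans ?_ (Measure.lintegral_compProd (hm4.comp hsnoc)).symm
    refine lintegral_congr fun h => ?_
    simp_rw [← lintegral_const_mul _ (hF2 _ _)]
    have hsw : Measurable fun x : (Vec d × (Fin m → Vec d)) ×
        ((Finset (Fin m) × (Fin m → Vec d)) × (Fin m → ℝ)) =>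
        ENNReal.ofReal (Real.exp (histLL σ x.1.2 h)) * F h x.1 x.2 := by
      refine (ENNReal.measurable_ofReal.comp (Real.measurable_exp.comp
        ((measurable_histLL σ).comp (f := fun x : (Vec d × (Fin m → Vec d)) ×
        ((Finset (Fin m) × (Fin m → Vec d)) × (Fin m → ℝ)) => (x.1.2, h)) (by fun_prop)))).mul ?_
      exact hFm.comp (f := fun x : (Vec d × (Fin m → Vec d)) ×
        ((Finset (Fin m) × (Fin m → Vec d)) × (Fin m → ℝ)) => ((h, x.1), x.2)) (by fun_prop)
    rw [lintegral_lintegral_swap hsw.aemeasurable]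
    refine lintegral_congr fun p => lintegral_congr fun e => ?_
    rw [hF, hL, histLL_histSnoc, Real.exp_add, ENNReal.ofReal_mul (Real.exp_nonneg _), mul_assoc]

end IsHierTS

end Interaction

end HierBandit

namespace HierBandit

/-! ### Posterior distributions -/

section Likelihood

variable {d m : ℕ} (σ : ℝ)

variable {t : ℕ}

lemma histLL_eq_sum (h : Hist d m t) (e : Vec d × (Fin m → Vec d)) :
    histLL σ e.2 h = ∑ p : Fin m × Fin t,
      ((h p.1 p.2).2.2 / σ ^ 2 * ((entryDual (h p.1 p.2)).comp
          ((ContinuousLinearMap.proj p.1).comp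
            (ContinuousLinearMap.snd ℝ (Vec d) (Fin m → Vec d)))) e -
        1 / (2 * σ ^ 2) * ((entryDual (h p.1 p.2)).comp
          ((ContinuousLinearMap.proj p.1).comp
            (ContinuousLinearMap.snd ℝ (Vec d) (Fin m → Vec d)))) e ^ 2) := by
  simp only [histLL, taskLL, Fintype.sum_prod_type, entryLL_eq_entryDual]
  rfl

variable {σ}

lemma integrable_exp_histLL (hσ : 0 < σ) (μ : Measure (Vec d × (Fin m → Vec d)))
    [IsFiniteMeasure μ] (h : Hist d m t) : Integrable (fun e => Real.exp (histLL σ e.2 h)) μ := by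
  simp_rw [histLL_eq_sum]
  exact integrable_exp_sum_quadratic μ _ _ _ fun _ => by positivity

lemma integrable_exp_histLL_snd (hσ : 0 < σ) (μ : Measure (Fin m → Vec d)) [IsFiniteMeasure μ]
    (h : Hist d m t) : Integrable (fun θ => Real.exp (histLL σ θ h)) μ := by
  have h1 := integrable_exp_histLL hσ (μ.map fun θ => ((0 : Vec d), θ)) h
  exact h1.comp_measurable (f := fun θ => ((0 : Vec d), θ)) (by fun_prop)

lemma integrable_exp_taskLL (hσ : 0 < σ) (μ : Measure (Vec d)) [IsFiniteMeasure μ]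
    (h : TaskHist d t) :
    Integrable (fun θ => Real.exp (taskLL σ θ h)) μ := by
  simp_rw [taskLL, entryLL_eq_entryDual]
  exact integrable_exp_sum_quadratic μ _ _ _ fun _ => by positivity

/-- The posterior law of the environment is Gaussian, with variances at most those of the prior. -/
lemma tilted_histLL (hσ : 0 < σ) (μ : Measure (Vec d × (Fin m → Vec d))) [IsGaussian μ]
    (h : Hist d m t) : IsGaussian (μ.tilted fun e => histLL σ e.2 h) ∧
      ∀ φ : StrongDual ℝ (Vec d × (Fin m → Vec d)),
        Var[φ; μ.tilted fun e => histLL σ e.2 h] ≤ Var[φ; μ] := by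
  simp_rw [histLL_eq_sum]
  exact tilted_sum_quadratic μ _ _ _ fun _ => by positivity

end Likelihood

section CondDistrib

variable {Ω α β : Type*} [MeasurableSpace Ω] [MeasurableSpace α] [MeasurableSpace β]
  {P : Measure Ω} {A : Ω → α} {B : Ω → β}

lemma hasCondDistrib_condDistrib [IsFiniteMeasure P] [StandardBorelSpace β] [Nonempty β]
    (hA : Measurable A) (hB : Measurable B) : HasCondDistrib B A (condDistrib B A P) P :=
  ⟨by fun_prop, (compProd_map_condDistrib hB.aemeasurable).symm⟩

lemma _root_.ProbabilityTheory.HasCondDistrib.condDistrib_ae_eq [IsFiniteMeasure P]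
    [StandardBorelSpace β] [Nonempty β] {κ : Kernel α β} [IsMarkovKernel κ]
    (h : HasCondDistrib B A κ P) : condDistrib B A P =ᵐ[P.map A] κ :=
  condDistrib_ae_eq_of_measure_eq_compProd A h.aemeasurable_snd h.map_eq

lemma _root_.ProbabilityTheory.HasCondDistrib.congr_kernel {κ η : Kernel α β}
    [IsMarkovKernel κ] [IsMarkovKernel η] (h : HasCondDistrib B A κ P) (hκ : κ =ᵐ[P.map A] η) :
    HasCondDistrib B A η P :=
  ⟨h.aemeasurable, by rw [h.map_eq, Measure.compProd_congr hκ]⟩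

end CondDistrib

namespace Interaction

variable {Ω : Type*} {d m n : ℕ} {X : Interaction Ω d m} {sel : Vec d → Vec d}
  [MeasurableSpace Ω] {P : Measure Ω} [IsProbabilityMeasure P]
  {μq : Vec d} {Sq S0 : Matrix (Fin d) (Fin d) ℝ} {σ : ℝ}

/-- The posterior law of `θ_{s,*}` given `H_t`. -/
def posterior (X : Interaction Ω d m) (sel : Vec d → Vec d) (P : Measure Ω)
    [IsProbabilityMeasure P] (s : Fin m) (t : ℕ) : Kernel (Hist d m t) (Vec d) :=
  condDistrib (X.thetaStar s) (X.hist sel t) P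

instance (s : Fin m) (t : ℕ) : IsMarkovKernel (X.posterior sel P s t) := by
  unfold posterior; infer_instance

namespace IsHierTS

/-- The posterior of the environment is the prior, tilted by the log-likelihood. -/
lemma env_law (hX : X.IsHierTS sel P μq Sq S0 σ n) (hsel : Measurable sel) (hσ : 0 < σ) (t : ℕ) :
    HasCondDistrib X.env (X.hist sel t)
      (tiltedKernel (Kernel.const (Hist d m t) (prior m μq Sq S0))
        fun h e => histLL σ e.2 h) P := by
  obtain ⟨ρ, hρ, hlaw⟩ := hX.exists_joint_law hsel hσ t
  refine hasCondDistrib_tiltedKernel _ (hX.measurable_hist hsel t) hX.measurable_env (ν := ρ)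
    ?_ (fun h => ?_) fun f hf => ?_
  · exact (measurable_histLL σ).comp
      (f := fun p : Hist d m t × (Vec d × (Fin m → Vec d)) => (p.2.2, p.1)) (by fun_prop)
  · exact integrable_exp_histLL hσ _ h
  · exact hlaw f hf

lemma posterior_ae_eq (hX : X.IsHierTS sel P μq Sq S0 σ n) (hsel : Measurable sel) (hσ : 0 < σ)
    (s : Fin m) (t : ℕ) :
    ∀ᵐ h ∂(P.map (X.hist sel t)), X.posterior sel P s t h =
      ((prior m μq Sq S0).tilted fun e => histLL σ e.2 h).map fun e => e.2 s := by
  have hF : Measurable (Function.uncurry fun (h : Hist d m t) (e : Vec d × (Fin m → Vec d)) =>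
      histLL σ e.2 h) := (measurable_histLL σ).comp
      (f := fun p : Hist d m t × (Vec d × (Fin m → Vec d)) => (p.2.2, p.1)) (by fun_prop)
  have hmk := isMarkovKernel_tiltedKernel (Kernel.const (Hist d m t) (prior m μq Sq S0)) hF
    fun h => integrable_exp_histLL hσ _ h
  have hms : Measurable fun e : Vec d × (Fin m → Vec d) => e.2 s := by fun_prop
  have h1 := (hX.env_law hsel hσ t).comp_left hms
  have hmk' := Kernel.IsMarkovKernel.map
    (tiltedKernel (Kernel.const (Hist d m t) (prior m μq Sq S0)) fun h e => histLL σ e.2 h) hms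
  have h2 : condDistrib (X.thetaStar s) (X.hist sel t) P =ᵐ[P.map (X.hist sel t)]
      (tiltedKernel (Kernel.const (Hist d m t) (prior m μq Sq S0))
        fun h e => histLL σ e.2 h).map fun e => e.2 s := h1.condDistrib_ae_eq
  filter_upwards [h2] with h hh
  rw [posterior, hh, Kernel.map_apply _ hms, tiltedKernel_apply _ hF, Kernel.const_apply]

/-- The posterior of a task parameter is Gaussian, with variances at most `σ_max²`. -/
lemma posterior_isGaussian (hX : X.IsHierTS sel P μq Sq S0 σ n) (hsel : Measurable sel)
    (hσ : 0 < σ) (hd : 0 < d) (hSq : Sq.PosSemidef) (hS0 : S0.PosDef) (s : Fin m) (t : ℕ) :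
    ∀ᵐ h ∂(P.map (X.hist sel t)), IsGaussian (X.posterior sel P s t h) ∧
      ∀ u, quadForm (covMat (X.posterior sel P s t h)) u ≤ sigmaMax S0 Sq ^ 2 * ‖u‖ ^ 2 := by
  filter_upwards [hX.posterior_ae_eq hsel hσ s t] with h hh
  obtain ⟨hG, hV⟩ := tilted_histLL hσ (prior m μq Sq S0) h
  set L : (Vec d × (Fin m → Vec d)) →L[ℝ] Vec d := (ContinuousLinearMap.proj s).comp
    (ContinuousLinearMap.snd ℝ (Vec d) (Fin m → Vec d)) with hL
  have hmap : X.posterior sel P s t h =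
      ((prior m μq Sq S0).tilted fun e => histLL σ e.2 h).map L := hh
  have hG' : IsGaussian (X.posterior sel P s t h) := by rw [hmap]; infer_instance
  refine ⟨hG', fun u => ?_⟩
  rw [quadForm_covMat IsGaussian.memLp_two_id, hmap, variance_map (by fun_prop) (by fun_prop)]
  exact (hV ((innerSL ℝ u).comp L)).trans (variance_inner_prior_le μq hd hSq hS0 s u)

/-- The task parameters are independent given `(H_t, μ_*)`, and the law of `θ_{s,*}` given
`(H_t, μ_*)` depends on `H_{s,t}` and `μ_*` only. -/
lemma thetaStar_condPosterior (hX : X.IsHierTS sel P μq Sq S0 σ n) (hsel : Measurable sel)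
    (hσ : 0 < σ) (s : Fin m) (t : ℕ) :
    HasCondDistrib (X.thetaStar s) (fun ω => (X.hist sel t ω, X.muStar ω))
      ((X.condPosterior sel P s t).comap (fun p : Hist d m t × Vec d => (p.1 s, p.2))
        (by fun_prop)) P := by
  obtain ⟨ρ, hρ, hlaw⟩ := hX.exists_joint_law hsel hσ t
  have hH := hX.measurable_hist hsel t
  have hμ := hX.measurable_muStar
  have hθ : Measurable fun ω s => X.thetaStar s ω :=
    measurable_pi_lambda _ hX.measurable_thetaStar
  set κ : Kernel (Hist d m t × Vec d) (Fin m → Vec d) :=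
    Kernel.prodMkLeft (Hist d m t) (piKernel fun _ : Fin m => gaussKernel S0) with hκ
  set F : Hist d m t × Vec d → (Fin m → Vec d) → ℝ := fun p θ => histLL σ θ p.1 with hF
  have hFm : Measurable (Function.uncurry F) := (measurable_histLL σ).comp
    (f := fun p : (Hist d m t × Vec d) × (Fin m → Vec d) => (p.2, p.1.1)) (by fun_prop)
  have hint : ∀ a, Integrable (fun b => Real.exp (F a b)) (κ a) := fun a =>
    integrable_exp_histLL_snd hσ (κ a) a.1
  have hmk := isMarkovKernel_tiltedKernel κ hFm hint
  have h1 : HasCondDistrib (fun ω s => X.thetaStar s ω) (fun ω => (X.hist sel t ω, X.muStar ω))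
      (tiltedKernel κ F) P := by
    refine hasCondDistrib_tiltedKernel κ (by fun_prop) hθ
      (ν := ρ.prod (multivariateGaussian μq Sq)) hFm hint fun f hf => ?_
    have hf' : Measurable fun p : (Hist d m t × Vec d) × (Fin m → Vec d) => f p.1 p.2 := hf
    have hm : Measurable fun p : (Hist d m t × Vec d) × (Fin m → Vec d) =>
        ENNReal.ofReal (Real.exp (F p.1 p.2)) * f p.1 p.2 :=
      (ENNReal.measurable_ofReal.comp (Real.measurable_exp.comp hFm)).mul hf'
    have h := hlaw (fun h e => f (h, e.1) e.2) (hf'.comp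
      (f := fun p : Hist d m t × (Vec d × (Fin m → Vec d)) => ((p.1, p.2.1), p.2.2))
        (by fun_prop))
    refine h.trans ?_
    rw [lintegral_prod _ (hm.lintegral_kernel_prod_right' (κ := κ)).aemeasurable]
    refine lintegral_congr fun h => ?_
    have hm2 : Measurable fun e : Vec d × (Fin m → Vec d) =>
        ENNReal.ofReal (Real.exp (histLL σ e.2 h)) * f (h, e.1) e.2 :=
      hm.comp (f := fun e : Vec d × (Fin m → Vec d) => ((h, e.1), e.2)) (by fun_prop)
    rw [prior, Measure.lintegral_compProd hm2]
    rfl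
  -- the posterior of a single task parameter given its own history and `μ_*`
  set τ : Kernel (TaskHist d t × Vec d) (Vec d) :=
    tiltedKernel (Kernel.prodMkLeft (TaskHist d t) (gaussKernel S0)) fun p θ => taskLL σ θ p.1
    with hτ
  have hτF : Measurable (Function.uncurry fun (p : TaskHist d t × Vec d) θ => taskLL σ θ p.1) :=
    (measurable_taskLL σ).comp (f := fun p : (TaskHist d t × Vec d) × Vec d => (p.2, p.1.1))
      (by fun_prop)
  have hτmk : IsMarkovKernel τ := isMarkovKernel_tiltedKernel _ hτF fun a =>
    integrable_exp_taskLL hσ _ a.1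
  have hproj : Measurable fun p : Hist d m t × Vec d => (p.1 s, p.2) := by fun_prop
  have hker : (tiltedKernel κ F).map (fun θ => θ s) = τ.comap (fun p => (p.1 s, p.2)) hproj := by
    ext1 p
    rw [Kernel.map_apply _ (measurable_pi_apply s), tiltedKernel_apply κ hFm, Kernel.comap_apply,
      hτ, tiltedKernel_apply _ hτF]
    have hpi := pi_tilted (fun _ : Fin m => gaussKernel S0 p.2)
      (f := fun s θ => taskLL σ θ (p.1 s))
      (fun s => (measurable_taskLL σ).comp (f := fun θ => (θ, p.1 s)) (by fun_prop))
      (fun s => integrable_exp_taskLL hσ _ (p.1 s))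
    have hprob : ∀ s, IsProbabilityMeasure
        ((gaussKernel S0 p.2).tilted fun θ => taskLL σ θ (p.1 s)) := fun s =>
      isProbabilityMeasure_tilted (integrable_exp_taskLL hσ _ (p.1 s))
    have hev := (measurePreserving_eval
      (fun s => (gaussKernel S0 p.2).tilted fun θ => taskLL σ θ (p.1 s)) s).map_eq
    rw [hpi] at hev
    exact hev
  have h2 : HasCondDistrib (X.thetaStar s) (fun ω => (X.hist sel t ω, X.muStar ω))
      (τ.comap (fun p => (p.1 s, p.2)) hproj) P := by
    rw [← hker]; exact h1.comp_left (measurable_pi_apply s)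
  have h3 : HasCondDistrib (X.thetaStar s) (fun ω => (X.taskHist sel s t ω, X.muStar ω)) τ P :=
    HasCondDistrib.comp_right (Z := fun ω => (X.hist sel t ω, X.muStar ω)) (hf := hproj) h2
  have h4 : X.condPosterior sel P s t
      =ᵐ[P.map fun ω => (X.taskHist sel s t ω, X.muStar ω)] τ := h3.condDistrib_ae_eq
  refine h2.congr_kernel ?_
  have h5 : P.map (fun ω => (X.taskHist sel s t ω, X.muStar ω)) =
      (P.map fun ω => (X.hist sel t ω, X.muStar ω)).map fun p => (p.1 s, p.2) := by
    rw [Measure.map_map hproj (by fun_prop)]; rfl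
  rw [h5] at h4
  filter_upwards [ae_of_ae_map hproj.aemeasurable h4] with p hp
  rw [Kernel.comap_apply, Kernel.comap_apply, hp]

/-- The other tasks' samples do not matter for the law of `θ_{s,t}`. -/
lemma sampleLaw_map_eval (s : Fin m) (t : ℕ) :
    (X.sampleLaw sel P t).map (fun θ => θ s) =
      (X.hyperPosterior sel P t ⊗ₖ (X.condPosterior sel P s t).comap
        (fun p : Hist d m t × Vec d => (p.1 s, p.2)) (by fun_prop)).snd := by
  ext1 h
  refine Measure.ext_of_lintegral _ fun f hf => ?_
  rw [Kernel.map_apply _ (measurable_pi_apply s), lintegral_map hf (measurable_pi_apply s),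
    sampleLaw, Kernel.lintegral_snd _ _ (by fun_prop), Kernel.lintegral_snd _ _ hf,
    Kernel.lintegral_compProd _ _ _ (by fun_prop), Kernel.lintegral_compProd _ _ _ (by fun_prop)]
  refine lintegral_congr fun μ => ?_
  have hev := (measurePreserving_eval (fun s => X.condPosterior sel P s t (h s, μ)) s).map_eq
  rw [Kernel.comap_apply, ← hev, lintegral_map hf (measurable_pi_apply s)]
  rfl

/-- Posterior sampling: given `H_t`, the sampled parameter `θ_{s,t}` has the same law as
`θ_{s,*}`. -/
lemma sampleLaw_ae_eq (hX : X.IsHierTS sel P μq Sq S0 σ n) (hsel : Measurable sel)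
    (hσ : 0 < σ) (s : Fin m) (t : ℕ) :
    X.posterior sel P s t =ᵐ[P.map (X.hist sel t)] (X.sampleLaw sel P t).map fun θ => θ s := by
  have h1 : HasCondDistrib X.muStar (X.hist sel t) (X.hyperPosterior sel P t) P :=
    hasCondDistrib_condDistrib (hX.measurable_hist hsel t) hX.measurable_muStar
  have h2 := (h1.compProd (hX.thetaStar_condPosterior hsel hσ s t)).snd
  rw [sampleLaw_map_eval]
  exact h2.condDistrib_ae_eq

/-- The sampled parameter `θ_{s,t}` is drawn from the posterior of `θ_{s,*}`, independently of the
environment and the tasks of round `t`. -/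
lemma thetaSample_posterior (hX : X.IsHierTS sel P μq Sq S0 σ n) (hsel : Measurable sel)
    (hσ : 0 < σ) (s : Fin m) (t : ℕ) :
    HasCondDistrib (X.thetaSample s t) (fun ω => ((X.env ω, X.tasks t ω), X.hist sel t ω))
      (Kernel.prodMkLeft _ (X.posterior sel P s t)) P := by
  have h1 := (hX.thetaSample_sampleLaw t).comp_left (measurable_pi_apply s)
  have hmk : IsMarkovKernel ((Kernel.prodMkLeft ((Vec d × (Fin m → Vec d)) × Finset (Fin m))
      (X.sampleLaw sel P t)).map fun θ => θ s) :=
    Kernel.IsMarkovKernel.map _ (measurable_pi_apply s)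
  refine HasCondDistrib.congr_kernel h1 ?_
  have hH := hX.measurable_hist hsel t
  have henv := hX.measurable_env
  have htasks := hX.measurable_tasks t
  have h2 := hX.sampleLaw_ae_eq hsel hσ s t
  have h3 : P.map (X.hist sel t) =
      (P.map fun ω => ((X.env ω, X.tasks t ω), X.hist sel t ω)).map Prod.snd := by
    rw [Measure.map_map (by fun_prop) (by fun_prop)]; rfl
  rw [h3] at h2
  filter_upwards [ae_of_ae_map measurable_snd.aemeasurable h2] with p hp
  rw [Kernel.map_apply _ (measurable_pi_apply s), Kernel.prodMkLeft_apply,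
    Kernel.prodMkLeft_apply, hp, Kernel.map_apply _ (measurable_pi_apply s)]

/-- The tasks of round `t` carry no information on `θ_{s,*}` beyond that of `H_t`. -/
lemma thetaStar_posterior (hX : X.IsHierTS sel P μq Sq S0 σ n) (hsel : Measurable sel)
    (s : Fin m) (t : ℕ) :
    HasCondDistrib (X.thetaStar s) (fun ω => (X.tasks t ω, X.hist sel t ω))
      (Kernel.prodMkLeft _ (X.posterior sel P s t)) P := by
  obtain ⟨ν, hν, hlaw⟩ := hX.tasks_law t
  have hH := hX.measurable_hist hsel t
  have h1 := hlaw.coarsen (f := fun e => e.2 s) (by fun_prop)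
  exact HasCondDistrib.symm_prodMkLeft (hX.measurable_thetaStar s) hH (hX.measurable_tasks t) h1
    (hasCondDistrib_condDistrib hH (hX.measurable_thetaStar s))

end IsHierTS

end Interaction

end HierBandit

namespace HierBandit

/-! ### Sums over the rounds in which tasks are active -/

section Rounds

open Filter Topology

variable {ι : Type*} {n : ℕ}

lemma card_filter_mem_le [DecidableEq ι] {S : ℕ → Finset ι} {s : ι}
    (hS : {t | s ∈ S t}.encard ≤ n) (T : ℕ) :
    ((Finset.range T).filter fun t => s ∈ S t).card ≤ n := by
  have h : (((Finset.range T).filter fun t => s ∈ S t : Finset ℕ) : Set ℕ) ⊆ {t | s ∈ S t} := by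
    intro t ht
    simpa using (Finset.mem_filter.1 (Finset.mem_coe.1 ht)).2
  have h2 := (Set.encard_le_encard h).trans hS
  rw [Set.encard_coe_eq_coe_finsetCard] at h2
  exact_mod_cast h2

variable [Fintype ι]

lemma sum_range_sum_le {S : ℕ → Finset ι} (hS : ∀ s, {t | s ∈ S t}.encard ≤ n)
    {x : ι → ℕ → ℝ} {b : ι → ℝ} (hb : ∀ s, 0 ≤ b s) (hx : ∀ s t, x s t ≤ b s) (T : ℕ) :
    ∑ t ∈ Finset.range T, ∑ s ∈ S t, x s t ≤ n * ∑ s, b s := by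
  classical
  have h : ∑ t ∈ Finset.range T, ∑ s ∈ S t, x s t =
      ∑ s, ∑ t ∈ (Finset.range T).filter fun t => s ∈ S t, x s t :=
    Finset.sum_comm' (by simp)
  rw [h, Finset.mul_sum]
  refine Finset.sum_le_sum fun s _ => ?_
  calc ∑ t ∈ (Finset.range T).filter fun t => s ∈ S t, x s t
      ≤ ((Finset.range T).filter fun t => s ∈ S t).card • b s :=
        Finset.sum_le_card_nsmul _ _ _ fun t _ => hx s t
    _ ≤ n * b s := by
        rw [nsmul_eq_mul]
        gcongr
        · exact hb s
        · exact card_filter_mem_le (hS s) T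

lemma summable_sum_mem {S : ℕ → Finset ι} (hS : ∀ s, {t | s ∈ S t}.encard ≤ n)
    (x : ι → ℕ → ℝ) : Summable fun t => ∑ s ∈ S t, x s t := by
  refine summable_of_hasFiniteSupport ((Set.finite_iUnion fun s =>
    Set.finite_of_encard_le_coe (hS s)).subset fun t ht => ?_)
  obtain ⟨s, hs, -⟩ := Finset.exists_ne_zero_of_sum_ne_zero (Function.mem_support.1 ht)
  exact Set.mem_iUnion.2 ⟨s, hs⟩

variable {Ω : Type*} {S : ℕ → Ω → Finset ι}

lemma sum_mem_eq_sum_indicator (x : ι → ℕ → Ω → ℝ) (t : ℕ) (ω : Ω) :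
    ∑ s ∈ S t ω, x s t ω = ∑ s, {ω | s ∈ S t ω}.indicator (x s t) ω := by
  classical
  simp only [Set.indicator_apply, Set.mem_ofPred_eq]
  rw [Finset.sum_ite_mem, Finset.univ_inter]

variable [MeasurableSpace Ω] {P : Measure Ω}

lemma measurable_sum_mem (hSm : ∀ s t, MeasurableSet {ω | s ∈ S t ω}) {x : ι → ℕ → Ω → ℝ}
    (hx : ∀ s t, Measurable (x s t)) (t : ℕ) : Measurable fun ω => ∑ s ∈ S t ω, x s t ω := by
  simp_rw [sum_mem_eq_sum_indicator]
  exact Finset.measurable_sum _ fun s _ => (hx s t).indicator (hSm s t)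

/-- If each index is active in at most `n` rounds, the sum over the rounds of nonnegative terms
with integrable bounds is integrable, and its mean is the limit of the means of the partial
sums. -/
lemma integrable_tsum_sum_mem (hSm : ∀ s t, MeasurableSet {ω | s ∈ S t ω})
    (hS : ∀ s, ∀ᵐ ω ∂P, {t | s ∈ S t ω}.encard ≤ n) {x : ι → ℕ → Ω → ℝ} {b : ι → Ω → ℝ}
    (hx : ∀ s t, Measurable (x s t)) (hb : ∀ s, Integrable (b s) P)
    (hx0 : ∀ s t, ∀ᵐ ω ∂P, 0 ≤ x s t ω) (hxb : ∀ s t, ∀ᵐ ω ∂P, x s t ω ≤ b s ω) :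
    (∀ T, Integrable (fun ω => ∑ t ∈ Finset.range T, ∑ s ∈ S t ω, x s t ω) P) ∧
    Integrable (fun ω => ∑' t, ∑ s ∈ S t ω, x s t ω) P ∧
    (∀ T, ∫ ω, ∑ t ∈ Finset.range T, ∑ s ∈ S t ω, x s t ω ∂P ≤
      ∫ ω, ∑' t, ∑ s ∈ S t ω, x s t ω ∂P) ∧
    Tendsto (fun T => ∫ ω, ∑ t ∈ Finset.range T, ∑ s ∈ S t ω, x s t ω ∂P) atTop
      (𝓝 (∫ ω, ∑' t, ∑ s ∈ S t ω, x s t ω ∂P)) := by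
  simp only [← ae_all_iff] at hS hx0 hxb
  have hm : ∀ T, Measurable fun ω => ∑ t ∈ Finset.range T, ∑ s ∈ S t ω, x s t ω := fun T =>
    Finset.measurable_sum _ fun t _ => measurable_sum_mem hSm hx t
  have hB : Integrable (fun ω => n * ∑ s, b s ω) P :=
    (integrable_finsetSum _ fun s _ => hb s).const_mul _
  have h0 : ∀ᵐ ω ∂P, ∀ t, 0 ≤ ∑ s ∈ S t ω, x s t ω := by
    filter_upwards [hx0] with ω h t
    exact Finset.sum_nonneg fun s _ => h s t
  have hle : ∀ T, ∀ᵐ ω ∂P, ‖∑ t ∈ Finset.range T, ∑ s ∈ S t ω, x s t ω‖ ≤ n * ∑ s, b s ω := by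
    intro T
    filter_upwards [hS, hx0, hxb, h0] with ω h1 h2 h3 h4
    rw [Real.norm_of_nonneg (Finset.sum_nonneg fun t _ => h4 t)]
    exact sum_range_sum_le h1 (fun s => (h2 s 0).trans (h3 s 0)) h3 T
  have hlim : ∀ᵐ ω ∂P, Tendsto (fun T => ∑ t ∈ Finset.range T, ∑ s ∈ S t ω, x s t ω) atTop
      (𝓝 (∑' t, ∑ s ∈ S t ω, x s t ω)) := by
    filter_upwards [hS] with ω h1
    exact (summable_sum_mem h1 fun s t => x s t ω).hasSum.tendsto_sum_nat
  have hi : ∀ T, Integrable (fun ω => ∑ t ∈ Finset.range T, ∑ s ∈ S t ω, x s t ω) P := fun T =>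
    hB.mono' (hm T).aestronglyMeasurable (hle T)
  have hi' : Integrable (fun ω => ∑' t, ∑ s ∈ S t ω, x s t ω) P := by
    refine hB.mono' (aestronglyMeasurable_of_tendsto_ae atTop
      (fun T => (hm T).aestronglyMeasurable) hlim) ?_
    filter_upwards [hlim, ae_all_iff.2 hle] with ω h1 h2
    exact le_of_tendsto' h1.norm h2
  refine ⟨hi, hi', fun T => integral_mono_ae (hi T) hi' ?_, ?_⟩
  · filter_upwards [hS, h0] with ω h1 h2
    exact (summable_sum_mem h1 fun s t => x s t ω).sum_le_tsum _ fun t _ => h2 t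
  · exact tendsto_integral_of_dominated_convergence _ (fun T => (hm T).aestronglyMeasurable) hB
      hle hlim

/-- Jensen's inequality for the square root. -/
lemma integral_sqrt_le [IsProbabilityMeasure P] {U : Ω → ℝ} (hU : Integrable U P)
    (hU0 : ∀ᵐ ω ∂P, 0 ≤ U ω) : ∫ ω, √(U ω) ∂P ≤ √(∫ ω, U ω ∂P) := by
  have hm : AEStronglyMeasurable (fun ω => √(U ω)) P :=
    Real.continuous_sqrt.comp_aestronglyMeasurable hU.1
  have hsq : (fun ω => √(U ω) ^ 2) =ᵐ[P] U := by
    filter_upwards [hU0] with ω h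
    exact Real.sq_sqrt h
  have hL : MemLp (fun ω => √(U ω)) 2 P :=
    (memLp_two_iff_integrable_sq hm).2 (hU.congr hsq.symm)
  -- the variance of `√U` is nonnegative
  have hv := variance_nonneg (fun ω => √(U ω)) P
  rw [variance_eq_sub hL] at hv
  refine Real.le_sqrt_of_sq_le ?_
  rw [← integral_congr_ae hsq]
  simpa using hv

/-- A bound on each term `x s t` by the square root of `v s t`, in mean and on the event that `s`
is active in round `t`, gives a bound on the sum, by the Cauchy–Schwarz inequality over the at
most `n * |ι|` active pairs and over the probability space. -/
lemma integral_tsum_sum_mem_le [IsProbabilityMeasure P]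
    (hSm : ∀ s t, MeasurableSet {ω | s ∈ S t ω})
    (hS : ∀ s, ∀ᵐ ω ∂P, {t | s ∈ S t ω}.encard ≤ n) {x v : ι → ℕ → Ω → ℝ} {b : ι → Ω → ℝ} {B : ℝ}
    (hx : ∀ s t, Measurable (x s t)) (hb : ∀ s, Integrable (b s) P)
    (hx0 : ∀ s t, ∀ᵐ ω ∂P, 0 ≤ x s t ω) (hxb : ∀ s t, ∀ᵐ ω ∂P, x s t ω ≤ b s ω)
    (hv : ∀ s t, Measurable (v s t))
    (hv0 : ∀ s t, ∀ᵐ ω ∂P, 0 ≤ v s t ω) (hvB : ∀ s t, ∀ᵐ ω ∂P, v s t ω ≤ B)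
    {C D : ℝ} (hC : 0 ≤ C) (hD : 0 ≤ D)
    (hxv : ∀ s t, ∫ ω in {ω | s ∈ S t ω}, x s t ω ∂P ≤
      C * ∫ ω in {ω | s ∈ S t ω}, √(v s t ω) ∂P + D * P.real {ω | s ∈ S t ω}) :
    ∫ ω, ∑' t, ∑ s ∈ S t ω, x s t ω ∂P ≤
      C * √(Fintype.card ι * n * ∫ ω, ∑' t, ∑ s ∈ S t ω, v s t ω ∂P) +
        D * (Fintype.card ι * n) := by
  classical
  obtain ⟨-, -, -, hxlim⟩ := integrable_tsum_sum_mem hSm hS hx hb hx0 hxb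
  obtain ⟨hvi, -, hvle, -⟩ := integrable_tsum_sum_mem hSm hS hv
    (fun _ => integrable_const B) hv0 hvB
  have hxi : ∀ s t, Integrable (x s t) P := fun s t => by
    refine (hb s).mono' (hx s t).aestronglyMeasurable ?_
    filter_upwards [hx0 s t, hxb s t] with ω h1 h2
    rwa [Real.norm_of_nonneg h1]
  have hsi : ∀ s t, Integrable (fun ω => √(v s t ω)) P := fun s t => by
    refine (integrable_const (√B)).mono' (hv s t).sqrt.aestronglyMeasurable ?_
    filter_upwards [hvB s t] with ω h2
    rw [Real.norm_of_nonneg (Real.sqrt_nonneg _)]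
    exact Real.sqrt_le_sqrt h2
  have hsum : ∀ (y : ι → ℕ → Ω → ℝ), (∀ s t, Integrable (y s t) P) → ∀ T,
      ∫ ω, ∑ t ∈ Finset.range T, ∑ s ∈ S t ω, y s t ω ∂P =
        ∑ t ∈ Finset.range T, ∑ s, ∫ ω in {ω | s ∈ S t ω}, y s t ω ∂P := by
    intro y hy T
    simp_rw [sum_mem_eq_sum_indicator]
    rw [integral_finsetSum _ fun t _ => integrable_finsetSum _ fun s _ =>
      (hy s t).indicator (hSm s t)]
    refine Finset.sum_congr rfl fun t _ => ?_
    rw [integral_finsetSum _ fun s _ => (hy s t).indicator (hSm s t)]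
    exact Finset.sum_congr rfl fun s _ => integral_indicator (hSm s t)
  have hS' := ae_all_iff.2 hS
  refine le_of_tendsto' hxlim fun T => ?_
  have hcard : ∀ᵐ ω ∂P, ∑ t ∈ Finset.range T, ∑ s ∈ S t ω, (1 : ℝ) ≤ Fintype.card ι * n := by
    filter_upwards [hS'] with ω h
    have := sum_range_sum_le h (x := fun _ _ => 1) (b := fun _ => 1) (fun _ => zero_le_one)
      (fun _ _ => le_rfl) T
    simpa [mul_comm] using this
  have h1 : ∫ ω, ∑ t ∈ Finset.range T, ∑ s ∈ S t ω, x s t ω ∂P ≤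
      C * ∫ ω, ∑ t ∈ Finset.range T, ∑ s ∈ S t ω, √(v s t ω) ∂P +
        D * ∫ ω, ∑ t ∈ Finset.range T, ∑ s ∈ S t ω, (1 : ℝ) ∂P := by
    rw [hsum x hxi T, hsum _ hsi T, hsum _ (fun _ _ => integrable_const 1) T]
    simp_rw [Finset.mul_sum, ← Finset.sum_add_distrib]
    refine Finset.sum_le_sum fun t _ => Finset.sum_le_sum fun s _ => (hxv s t).trans_eq ?_
    simp
  have h1i : Integrable (fun ω => ∑ t ∈ Finset.range T, ∑ s ∈ S t ω, (1 : ℝ)) P := by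
    simp_rw [sum_mem_eq_sum_indicator (x := fun _ _ _ => (1 : ℝ))]
    exact integrable_finsetSum _ fun t _ => integrable_finsetSum _ fun s _ =>
      (integrable_const _).indicator (hSm s t)
  have h2 : ∫ ω, ∑ t ∈ Finset.range T, ∑ s ∈ S t ω, (1 : ℝ) ∂P ≤ Fintype.card ι * n := by
    refine (integral_mono_ae h1i (integrable_const _) hcard).trans_eq ?_
    simp
  have hv0' : ∀ᵐ ω ∂P, ∀ s t, 0 ≤ v s t ω := by simpa only [ae_all_iff] using hv0
  have hU0 : ∀ᵐ ω ∂P, 0 ≤ ∑ t ∈ Finset.range T, ∑ s ∈ S t ω, v s t ω := by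
    filter_upwards [hv0'] with ω h
    exact Finset.sum_nonneg fun t _ => Finset.sum_nonneg fun s _ => h s t
  have h3 : ∫ ω, ∑ t ∈ Finset.range T, ∑ s ∈ S t ω, √(v s t ω) ∂P ≤
      ∫ ω, √(Fintype.card ι * n) * √(∑ t ∈ Finset.range T, ∑ s ∈ S t ω, v s t ω) ∂P := by
    have hsqU : Integrable (fun ω => √(∑ t ∈ Finset.range T, ∑ s ∈ S t ω, v s t ω)) P := by
      refine ((hvi T).add (integrable_const 1)).mono'
        (Real.continuous_sqrt.comp_aestronglyMeasurable (hvi T).1) ?_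
      filter_upwards [hU0] with ω h
      rw [Real.norm_of_nonneg (Real.sqrt_nonneg _)]
      refine Real.sqrt_le_iff.2 ⟨by simp only [Pi.add_apply]; linarith, ?_⟩
      simp only [Pi.add_apply]
      nlinarith
    refine integral_mono_ae ?_ (hsqU.const_mul _) ?_
    · simp_rw [sum_mem_eq_sum_indicator (x := fun s t ω => √(v s t ω))]
      exact integrable_finsetSum _ fun t _ => integrable_finsetSum _ fun s _ =>
        (hsi s t).indicator (hSm s t)
    · filter_upwards [hv0', hcard] with ω hω hc
      -- Cauchy–Schwarz with all weights equal to one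
      have hcs := Real.sum_sqrt_mul_sqrt_le ((Finset.range T).sigma fun t => S t ω)
        (f := fun _ => 1) (g := fun p => v p.2 p.1 ω) (fun _ => zero_le_one)
        (fun p => hω p.2 p.1)
      simp only [Finset.sum_sigma, Real.sqrt_one, one_mul] at hcs
      exact hcs.trans (by gcongr)
  rw [integral_const_mul] at h3
  have h4 := (integral_sqrt_le (hvi T) hU0).trans (Real.sqrt_le_sqrt (hvle T))
  calc _ ≤ _ := h1
    _ ≤ C * (√(Fintype.card ι * n) * √(∫ ω, ∑' t, ∑ s ∈ S t ω, v s t ω ∂P)) +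
        D * (Fintype.card ι * n) := by
      gcongr
      exact h3.trans (by gcongr)
    _ = _ := by rw [Real.sqrt_mul (by positivity) (∫ ω, ∑' t, ∑ s ∈ S t ω, v s t ω ∂P)]

end Rounds

end HierBandit

namespace HierBandit

/-! ### The regret of a round -/

section CondDistrib

variable {Ω α β : Type*} [MeasurableSpace Ω] [MeasurableSpace α] [MeasurableSpace β]
  {P : Measure Ω} [IsProbabilityMeasure P] {A : Ω → α} {B : Ω → β}

lemma _root_.ProbabilityTheory.HasCondDistrib.integrable {κ : Kernel α β} [IsMarkovKernel κ]
    (h : HasCondDistrib B A κ P) {f : α × β → ℝ} (hf : Measurable f)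
    (hi : Integrable (fun ω => f (A ω, B ω)) P) :
    Integrable (fun ω => ∫ b, f (A ω, b) ∂(κ (A ω))) P := by
  have hi' : Integrable f (P.map A ⊗ₘ κ) := by
    rwa [← h.map_eq, integrable_map_measure hf.aestronglyMeasurable h.aemeasurable]
  have hm : StronglyMeasurable fun a => ∫ b, f (a, b) ∂(κ a) :=
    hf.stronglyMeasurable.integral_kernel_prod_right'
  have h2 : Integrable (fun a => ∫ b, f (a, b) ∂(κ a)) (P.map A) :=
    ((Measure.integrable_compProd_iff hi'.1).1 hi').2.mono hm.aestronglyMeasurable <|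
      ae_of_all _ fun a => (norm_integral_le_integral_norm _).trans (le_abs_self _)
  exact h2.comp_aemeasurable h.aemeasurable_fst

lemma _root_.ProbabilityTheory.HasCondDistrib.integral_eq {κ : Kernel α β} [IsMarkovKernel κ]
    (h : HasCondDistrib B A κ P) {f : α × β → ℝ} (hf : Measurable f)
    (hi : Integrable (fun ω => f (A ω, B ω)) P) :
    ∫ ω, f (A ω, B ω) ∂P = ∫ ω, ∫ b, f (A ω, b) ∂(κ (A ω)) ∂P := by
  have hi' : Integrable f (P.map A ⊗ₘ κ) := by
    rwa [← h.map_eq, integrable_map_measure hf.aestronglyMeasurable h.aemeasurable]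
  have hm : StronglyMeasurable fun a => ∫ b, f (a, b) ∂(κ a) :=
    hf.stronglyMeasurable.integral_kernel_prod_right'
  rw [← integral_map (f := f) h.aemeasurable hf.aestronglyMeasurable, h.map_eq,
    Measure.integral_compProd hi', integral_map h.aemeasurable_fst hm.aestronglyMeasurable]

lemma _root_.ProbabilityTheory.HasCondDistrib.setIntegral_eq {κ : Kernel α β} [IsMarkovKernel κ]
    (h : HasCondDistrib B A κ P) (hA : Measurable A) {s : Set α} (hs : MeasurableSet s)
    {f : α × β → ℝ} (hf : Measurable f) (hi : Integrable (fun ω => f (A ω, B ω)) P) :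
    ∫ ω in A ⁻¹' s, f (A ω, B ω) ∂P = ∫ ω in A ⁻¹' s, ∫ b, f (A ω, b) ∂(κ (A ω)) ∂P := by
  have hs' : MeasurableSet (Prod.fst ⁻¹' s : Set (α × β)) := measurable_fst hs
  rw [← integral_indicator (hA hs), ← integral_indicator (hA hs)]
  have h1 := h.integral_eq (hf.indicator hs') (hi.indicator (hA hs))
  refine h1.trans (integral_congr_ae (ae_of_all _ fun ω => ?_))
  by_cases hω : A ω ∈ s <;> simp [Set.indicator, hω]

end CondDistrib

namespace Interaction

variable {Ω : Type*} {d m n : ℕ} {X : Interaction Ω d m} {sel : Vec d → Vec d}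
  [MeasurableSpace Ω] {P : Measure Ω} [IsProbabilityMeasure P]
  {μq : Vec d} {Sq S0 : Matrix (Fin d) (Fin d) ℝ} {σ : ℝ}

/-- The posterior variance `A_{s,t}ᵀ Σ̂_{s,t} A_{s,t}` of the mean reward of the action taken. -/
def postVar (X : Interaction Ω d m) (sel : Vec d → Vec d) (P : Measure Ω)
    [IsProbabilityMeasure P] (s : Fin m) (t : ℕ) (ω : Ω) : ℝ :=
  quadForm (covMat (X.posterior sel P s t (X.hist sel t ω))) (X.action sel s t ω)

/-- The regret `A_{s,*}ᵀ θ_{s,*} - A_{s,t}ᵀ θ_{s,*}` of task `s` in round `t`. -/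
def roundRegret (X : Interaction Ω d m) (sel : Vec d → Vec d) (s : Fin m) (t : ℕ) (ω : Ω) : ℝ :=
  inner ℝ (X.optAction sel s ω) (X.thetaStar s ω) - inner ℝ (X.action sel s t ω) (X.thetaStar s ω)

lemma measurable_quadForm_posterior (s : Fin m) (t : ℕ) :
    Measurable fun p : Hist d m t × Vec d => quadForm (covMat (X.posterior sel P s t p.1)) p.2 := by
  have hmean : ∀ i, Measurable fun h : Hist d m t => ∫ θ, θ i ∂(X.posterior sel P s t h) := fun i =>
    (StronglyMeasurable.integral_kernel_prod_right' (κ := X.posterior sel P s t)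
      (f := fun p : Hist d m t × Vec d => p.2 i)
      (by fun_prop : Measurable _).stronglyMeasurable).measurable
  have hcov : ∀ i j, Measurable fun h : Hist d m t => covMat (X.posterior sel P s t h) i j := by
    intro i j
    have hi : Measurable fun p : Hist d m t × Vec d => ∫ θ, θ i ∂(X.posterior sel P s t p.1) :=
      (hmean i).comp measurable_fst
    have hj : Measurable fun p : Hist d m t × Vec d => ∫ θ, θ j ∂(X.posterior sel P s t p.1) :=
      (hmean j).comp measurable_fst
    have hij : Measurable fun p : Hist d m t × Vec d =>
        (p.2 i - ∫ θ, θ i ∂(X.posterior sel P s t p.1)) *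
          (p.2 j - ∫ θ, θ j ∂(X.posterior sel P s t p.1)) :=
      Measurable.mul (by fun_prop) (by fun_prop)
    exact (StronglyMeasurable.integral_kernel_prod_right' (κ := X.posterior sel P s t)
      (f := fun p : Hist d m t × Vec d =>
        (p.2 i - ∫ θ, θ i ∂(X.posterior sel P s t p.1)) *
          (p.2 j - ∫ θ, θ j ∂(X.posterior sel P s t p.1)))
      hij.stronglyMeasurable).measurable
  simp only [quadForm, dotProduct, Matrix.mulVec]
  refine Finset.measurable_sum _ fun i _ => ?_
  refine Measurable.mul (by fun_prop) (Finset.measurable_sum _ fun j _ => ?_)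
  exact ((hcov i j).comp measurable_fst).mul (by fun_prop)

namespace IsHierTS

lemma measurable_postVar (hX : X.IsHierTS sel P μq Sq S0 σ n) (hsel : Measurable sel) (s : Fin m)
    (t : ℕ) : Measurable (X.postVar sel P s t) :=
  (measurable_quadForm_posterior s t).comp
    ((hX.measurable_hist hsel t).prodMk (hX.measurable_action hsel s t))

lemma measurable_roundRegret (hX : X.IsHierTS sel P μq Sq S0 σ n) (hsel : Measurable sel)
    (s : Fin m) (t : ℕ) : Measurable (X.roundRegret sel s t) := by
  have h1 := hX.measurable_action hsel s t
  have h2 := hX.measurable_thetaStar s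
  have h3 : Measurable (X.optAction sel s) := hsel.comp h2
  unfold roundRegret
  fun_prop

lemma integrable_thetaStar (hX : X.IsHierTS sel P μq Sq S0 σ n) (s : Fin m) :
    Integrable (X.thetaStar s) P := by
  have h : Integrable (fun e : Vec d × (Fin m → Vec d) => e.2 s) (prior m μq Sq S0) :=
    ((ContinuousLinearMap.proj (R := ℝ) (φ := fun _ : Fin m => Vec d) s).comp
      (ContinuousLinearMap.snd ℝ (Vec d) (Fin m → Vec d))).integrable_comp
        (IsGaussian.integrable_id (μ := prior m μq Sq S0))
  rw [← hX.hasLaw_env.map_eq] at h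
  exact h.comp_measurable hX.measurable_env

lemma postVar_bounds (hX : X.IsHierTS sel P μq Sq S0 σ n) (hsel : Measurable sel)
    (h1 : ∀ θ, ‖sel θ‖ ≤ 1) (hσ : 0 < σ) (hd : 0 < d) (hSq : Sq.PosSemidef) (hS0 : S0.PosDef)
    (s : Fin m) (t : ℕ) :
    ∀ᵐ ω ∂P, 0 ≤ X.postVar sel P s t ω ∧ X.postVar sel P s t ω ≤ sigmaMax S0 Sq ^ 2 := by
  filter_upwards [ae_of_ae_map (hX.measurable_hist hsel t).aemeasurable
    (hX.posterior_isGaussian hsel hσ hd hSq hS0 s t)] with ω ⟨hG, hV⟩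
  constructor
  · rw [postVar, quadForm_covMat IsGaussian.memLp_two_id]
    exact variance_nonneg _ _
  · refine (hV _).trans (mul_le_of_le_one_right (sq_nonneg _) ?_)
    exact pow_le_one₀ (norm_nonneg _) (h1 _)

/-- Given `H_t`, the action taken and the optimal action have the same law, and the action taken
is independent of `θ_{s,*}`; so the mean regret is that of choosing `sel θ` against the mean of
`θ`, for `θ` drawn from the posterior. -/
lemma setIntegral_roundRegret (hX : X.IsHierTS sel P μq Sq S0 σ n) (hsel : Measurable sel)
    (h1 : ∀ θ, ‖sel θ‖ ≤ 1) (hσ : 0 < σ) (hd : 0 < d) (hSq : Sq.PosSemidef) (hS0 : S0.PosDef)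
    (s : Fin m) (t : ℕ) :
    Integrable (fun ω => ∫ θ, inner ℝ (sel θ)
        (θ - ∫ θ', θ' ∂(X.posterior sel P s t (X.hist sel t ω)))
          ∂(X.posterior sel P s t (X.hist sel t ω))) P ∧
    ∫ ω in {ω | s ∈ X.tasks t ω}, X.roundRegret sel s t ω ∂P =
      ∫ ω in {ω | s ∈ X.tasks t ω}, ∫ θ, inner ℝ (sel θ)
        (θ - ∫ θ', θ' ∂(X.posterior sel P s t (X.hist sel t ω)))
          ∂(X.posterior sel P s t (X.hist sel t ω)) ∂P := by
  have hH := hX.measurable_hist hsel t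
  have hT := hX.measurable_tasks t
  have hE := hX.measurable_env
  have hθ := hX.measurable_thetaStar s
  have hθi := hX.integrable_thetaStar s
  have hθs := hX.measurable_thetaSample s t
  have hA := hX.measurable_action hsel s t
  have hO : Measurable (X.optAction sel s) := hsel.comp hθ
  have hO1 : ∀ ω, ‖X.optAction sel s ω‖ ≤ 1 := fun ω => h1 _
  have hA1 : ∀ ω, ‖X.action sel s t ω‖ ≤ 1 := fun ω => h1 _
  -- the mean action under the posterior
  have hbar : Measurable fun h : Hist d m t => ∫ θ, sel θ ∂(X.posterior sel P s t h) :=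
    (StronglyMeasurable.integral_kernel_prod_right' (κ := X.posterior sel P s t)
      (f := fun p : Hist d m t × Vec d => sel p.2)
      (by fun_prop : Measurable _).stronglyMeasurable).measurable
  have hseli : ∀ h, Integrable sel (X.posterior sel P s t h) := fun h =>
    Integrable.of_bound hsel.aestronglyMeasurable 1 (ae_of_all _ h1)
  have hbar1 : ∀ h, ‖∫ θ, sel θ ∂(X.posterior sel P s t h)‖ ≤ 1 := fun h =>
    (norm_integral_le_of_norm_le_const (ae_of_all _ h1)).trans (by simp)
  have hint : ∀ {f : Ω → Vec d}, Measurable f → (∀ ω, ‖f ω‖ ≤ 1) →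
      Integrable (fun ω => (inner ℝ (f ω) (X.thetaStar s ω) : ℝ)) P := fun {f} hf hf1 =>
    hθi.mono (by fun_prop) (ae_of_all _ fun ω => (norm_inner_le_norm _ _).trans
      (mul_le_of_le_one_left (norm_nonneg _) (hf1 ω)))
  have hset : MeasurableSet {p : Finset (Fin m) × Hist d m t | s ∈ p.1} :=
    measurable_fst (measurableSet_mem_finset s)
  have hset' : MeasurableSet {p : ((Vec d × (Fin m → Vec d)) × Finset (Fin m)) × Hist d m t |
      s ∈ p.1.2} := (measurable_snd.comp measurable_fst) (measurableSet_mem_finset s)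
  have hTH : Measurable fun ω => (X.tasks t ω, X.hist sel t ω) := hT.prodMk hH
  have hpost := hX.thetaStar_posterior hsel s t
  have hfO : Measurable fun p : (Finset (Fin m) × Hist d m t) × Vec d =>
      (inner ℝ (sel p.2) p.2 : ℝ) := by fun_prop
  have hfB : Measurable fun p : (Finset (Fin m) × Hist d m t) × Vec d =>
      (inner ℝ (∫ θ, sel θ ∂(X.posterior sel P s t p.1.2)) p.2 : ℝ) :=
    Measurable.inner (hbar.comp (measurable_snd.comp measurable_fst)) measurable_snd
  have e1 := hpost.setIntegral_eq hTH hset hfO (hint hO hO1)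
  have e2 := hpost.setIntegral_eq hTH hset hfB
    (hint (f := fun ω => ∫ θ, sel θ ∂(X.posterior sel P s t (X.hist sel t ω))) (hbar.comp hH)
      fun ω => hbar1 _)
  have i1 := hpost.integrable hfO (hint hO hO1)
  have i2 := hpost.integrable hfB
    (hint (f := fun ω => ∫ θ, sel θ ∂(X.posterior sel P s t (X.hist sel t ω))) (hbar.comp hH)
      fun ω => hbar1 _)
  have e3 := (hX.thetaSample_posterior hsel hσ s t).setIntegral_eq
    ((hE.prodMk hT).prodMk hH) hset' (f := fun p => (inner ℝ (sel p.2) (p.1.1.1.2 s) : ℝ))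
    (by fun_prop) (hint hA hA1)
  have e4 : ∀ ω, ∫ θ, (inner ℝ (sel θ) (X.thetaStar s ω) : ℝ)
      ∂(X.posterior sel P s t (X.hist sel t ω)) =
      inner ℝ (∫ θ, sel θ ∂(X.posterior sel P s t (X.hist sel t ω))) (X.thetaStar s ω) :=
    fun ω => by
      simp_rw [fun θ => real_inner_comm (X.thetaStar s ω) (sel θ)]
      rw [integral_inner (hseli _), real_inner_comm]
  -- replace `A_{s,t}` by its conditional mean, and then `θ_{s,*}` by its conditional law
  simp only [Kernel.prodMkLeft_apply] at e1 e2 e3 i1 i2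
  replace e3 := e3.trans (integral_congr_ae (ae_of_all _ e4))
  have hsub : ∫ ω in {ω | s ∈ X.tasks t ω}, X.roundRegret sel s t ω ∂P =
      ∫ ω in {ω | s ∈ X.tasks t ω}, inner ℝ (X.optAction sel s ω) (X.thetaStar s ω) ∂P -
      ∫ ω in {ω | s ∈ X.tasks t ω}, inner ℝ (X.action sel s t ω) (X.thetaStar s ω) ∂P :=
    integral_sub (hint hO hO1).integrableOn (hint hA hA1).integrableOn
  suffices hae : ∀ᵐ ω ∂P, ∫ θ, inner ℝ (sel θ) θ ∂(X.posterior sel P s t (X.hist sel t ω)) -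
      ∫ θ', inner ℝ (∫ θ, sel θ ∂(X.posterior sel P s t (X.hist sel t ω))) θ'
        ∂(X.posterior sel P s t (X.hist sel t ω)) =
      ∫ θ, inner ℝ (sel θ) (θ - ∫ θ', θ' ∂(X.posterior sel P s t (X.hist sel t ω)))
          ∂(X.posterior sel P s t (X.hist sel t ω)) by
    refine ⟨(i1.sub i2).congr hae, hsub.trans (((congrArg₂ (· - ·) e1 (e3.trans e2)).trans
      (integral_sub i1.integrableOn i2.integrableOn).symm).trans ?_)⟩
    exact integral_congr_ae (ae_restrict_of_ae hae)
  filter_upwards [ae_of_ae_map hH.aemeasurable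
    (hX.posterior_isGaussian hsel hσ hd hSq hS0 s t)] with ω hω
  have hG := hω.1
  set π := X.posterior sel P s t (X.hist sel t ω) with hπ
  have hπi : Integrable id π := IsGaussian.integrable_id
  have i3 := integrable_inner_sel_sub hπi hsel h1 0
  simp only [sub_zero] at i3
  have hmean : ∀ c : Vec d, ∫ θ, (inner ℝ (sel θ) c : ℝ) ∂π = inner ℝ (∫ θ, sel θ ∂π) c :=
    fun c => by
      simp_rw [fun θ => real_inner_comm c (sel θ)]
      rw [integral_inner (hseli _), real_inner_comm]
  simp_rw [inner_sub_right]
  rw [integral_sub i3 ((hseli _).inner_const _), hmean]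
  congr 1
  exact integral_inner hπi _

/-- The mean of `√(A_{s,t}ᵀ Σ̂_{s,t} A_{s,t})`, integrating out `θ_{s,t}` given `H_t`. -/
lemma setIntegral_sqrt_postVar (hX : X.IsHierTS sel P μq Sq S0 σ n) (hsel : Measurable sel)
    (h1 : ∀ θ, ‖sel θ‖ ≤ 1) (hσ : 0 < σ) (hd : 0 < d) (hSq : Sq.PosSemidef) (hS0 : S0.PosDef)
    (s : Fin m) (t : ℕ) :
    Integrable (fun ω => ∫ θ,
        √(quadForm (covMat (X.posterior sel P s t (X.hist sel t ω))) (sel θ))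
          ∂(X.posterior sel P s t (X.hist sel t ω))) P ∧
    ∫ ω in {ω | s ∈ X.tasks t ω}, √(X.postVar sel P s t ω) ∂P =
      ∫ ω in {ω | s ∈ X.tasks t ω}, ∫ θ,
        √(quadForm (covMat (X.posterior sel P s t (X.hist sel t ω))) (sel θ))
          ∂(X.posterior sel P s t (X.hist sel t ω)) ∂P := by
  have hH := hX.measurable_hist hsel t
  have hT := hX.measurable_tasks t
  have hE := hX.measurable_env
  have hm := hX.measurable_postVar hsel s t
  have hint : Integrable (fun ω => √(X.postVar sel P s t ω)) P := by
    refine (integrable_const √(sigmaMax S0 Sq ^ 2)).mono' hm.sqrt.aestronglyMeasurable ?_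
    filter_upwards [hX.postVar_bounds hsel h1 hσ hd hSq hS0 s t] with ω hω
    rw [Real.norm_of_nonneg (Real.sqrt_nonneg _)]
    exact Real.sqrt_le_sqrt hω.2
  have hset' : MeasurableSet {p : ((Vec d × (Fin m → Vec d)) × Finset (Fin m)) × Hist d m t |
      s ∈ p.1.2} := (measurable_snd.comp measurable_fst) (measurableSet_mem_finset s)
  have hf : Measurable
      fun p : (((Vec d × (Fin m → Vec d)) × Finset (Fin m)) × Hist d m t) × Vec d =>
      √(quadForm (covMat (X.posterior sel P s t p.1.2)) (sel p.2)) :=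
    ((measurable_quadForm_posterior s t).comp
      (f := fun p : (((Vec d × (Fin m → Vec d)) × Finset (Fin m)) × Hist d m t) × Vec d =>
        (p.1.2, sel p.2)) (by fun_prop)).sqrt
  have hlaw := hX.thetaSample_posterior hsel hσ s t
  exact ⟨hlaw.integrable hf hint, hlaw.setIntegral_eq ((hE.prodMk hT).prodMk hH) hset' hf hint⟩

/-- A bound for Gaussian vectors on the mean regret of choosing `sel θ` against the mean of `θ`
gives a bound on the mean regret of a round. -/
lemma setIntegral_roundRegret_le (hX : X.IsHierTS sel P μq Sq S0 σ n) (hsel : Measurable sel)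
    (h1 : ∀ θ, ‖sel θ‖ ≤ 1) (hσ : 0 < σ) (hd : 0 < d) (hSq : Sq.PosSemidef) (hS0 : S0.PosDef)
    {C D : ℝ} (hCD : ∀ π : Measure (Vec d), IsGaussian π →
      (∀ u, quadForm (covMat π) u ≤ sigmaMax S0 Sq ^ 2 * ‖u‖ ^ 2) →
      ∫ θ, inner ℝ (sel θ) (θ - ∫ θ', θ' ∂π) ∂π ≤
        C * ∫ θ, √(quadForm (covMat π) (sel θ)) ∂π + D) (s : Fin m) (t : ℕ) :
    ∫ ω in {ω | s ∈ X.tasks t ω}, X.roundRegret sel s t ω ∂P ≤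
      C * ∫ ω in {ω | s ∈ X.tasks t ω}, √(X.postVar sel P s t ω) ∂P +
        D * P.real {ω | s ∈ X.tasks t ω} := by
  obtain ⟨i1, e1⟩ := hX.setIntegral_roundRegret hsel h1 hσ hd hSq hS0 s t
  obtain ⟨i2, e2⟩ := hX.setIntegral_sqrt_postVar hsel h1 hσ hd hSq hS0 s t
  rw [e1, e2]
  have hle : ∀ᵐ ω ∂P, ∫ θ, inner ℝ (sel θ)
        (θ - ∫ θ', θ' ∂(X.posterior sel P s t (X.hist sel t ω)))
          ∂(X.posterior sel P s t (X.hist sel t ω)) ≤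
      C * ∫ θ, √(quadForm (covMat (X.posterior sel P s t (X.hist sel t ω))) (sel θ))
          ∂(X.posterior sel P s t (X.hist sel t ω)) + D := by
    filter_upwards [ae_of_ae_map (hX.measurable_hist hsel t).aemeasurable
      (hX.posterior_isGaussian hsel hσ hd hSq hS0 s t)] with ω hω
    exact hCD _ hω.1 hω.2
  have i3 := (i2.const_mul C).integrableOn (s := {ω | s ∈ X.tasks t ω})
  refine (setIntegral_mono_ae i1.integrableOn
    ((i2.const_mul C).add (integrable_const D)).integrableOn hle).trans_eq ?_
  rw [integral_add' i3 (integrable_const D), integral_const_mul]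
  simp [mul_comm]

/-- A bound for Gaussian vectors on the mean regret of choosing `sel θ` against the mean of `θ`
gives a bound on the Bayes regret. -/
lemma bayesRegret_le {𝒜 : Set (Vec d)} (hX : X.IsHierTS sel P μq Sq S0 σ n)
    (hsel : IsArgmax 𝒜 sel) (h1 : ∀ θ, ‖sel θ‖ ≤ 1) (hσ : 0 < σ) (hd : 0 < d)
    (hSq : Sq.PosSemidef) (hS0 : S0.PosDef) :
    Integrable (X.regret sel) P ∧ Integrable (X.sumPostVar sel P) P ∧
      ∀ C D : ℝ, 0 ≤ C → 0 ≤ D → (∀ π : Measure (Vec d), IsGaussian π →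
        (∀ u, quadForm (covMat π) u ≤ sigmaMax S0 Sq ^ 2 * ‖u‖ ^ 2) →
        ∫ θ, inner ℝ (sel θ) (θ - ∫ θ', θ' ∂π) ∂π ≤
          C * ∫ θ, √(quadForm (covMat π) (sel θ)) ∂π + D) →
        X.bayesRegret sel P ≤ C * √(m * n * X.expPostVar sel P) + D * (m * n) := by
  have hm := hsel.measurable
  have hSm : ∀ s t, MeasurableSet {ω | s ∈ X.tasks t ω} := hX.measurableSet_mem_tasks
  have hr : ∀ s t, Measurable (X.roundRegret sel s t) := hX.measurable_roundRegret hm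
  have hr0 : ∀ s t ω, 0 ≤ X.roundRegret sel s t ω := fun s t ω =>
    sub_nonneg.2 (hsel.isMaxOn (X.thetaStar s ω) (hsel.mem _))
  have hrb : ∀ s t ω, X.roundRegret sel s t ω ≤ 2 * ‖X.thetaStar s ω‖ := fun s t ω => by
    have hO := (norm_inner_le_norm (𝕜 := ℝ) (X.optAction sel s ω) (X.thetaStar s ω)).trans
      (mul_le_of_le_one_left (norm_nonneg _) (h1 _))
    have hA := (norm_inner_le_norm (𝕜 := ℝ) (X.action sel s t ω) (X.thetaStar s ω)).trans
      (mul_le_of_le_one_left (norm_nonneg _) (h1 _))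
    rw [Real.norm_eq_abs] at hO hA
    unfold roundRegret
    linarith [le_abs_self (inner ℝ (X.optAction sel s ω) (X.thetaStar s ω) : ℝ),
      neg_abs_le (inner ℝ (X.action sel s t ω) (X.thetaStar s ω) : ℝ)]
  have hb : ∀ s, Integrable (fun ω => 2 * ‖X.thetaStar s ω‖) P := fun s =>
    (hX.integrable_thetaStar s).norm.const_mul 2
  have hv : ∀ s t, Measurable (X.postVar sel P s t) := hX.measurable_postVar hm
  have hvb := hX.postVar_bounds hm h1 hσ hd hSq hS0
  refine ⟨(integrable_tsum_sum_mem hSm hX.tasks_card hr hb (fun s t => ae_of_all _ (hr0 s t))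
    fun s t => ae_of_all _ (hrb s t)).2.1, (integrable_tsum_sum_mem hSm hX.tasks_card hv
      (fun _ => integrable_const (sigmaMax S0 Sq ^ 2)) (fun s t => (hvb s t).mono fun _ h => h.1)
      fun s t => (hvb s t).mono fun _ h => h.2).2.1, fun C D hC hD hCD => ?_⟩
  have := integral_tsum_sum_mem_le hSm hX.tasks_card hr hb (fun s t => ae_of_all _ (hr0 s t))
    (fun s t => ae_of_all _ (hrb s t)) hv (fun s t => (hvb s t).mono fun _ h => h.1)
    (fun s t => (hvb s t).mono fun _ h => h.2) hC hD
    fun s t => hX.setIntegral_roundRegret_le hm h1 hσ hd hSq hS0 hCD s t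
  rwa [Fintype.card_fin] at this

end IsHierTS

end Interaction

end HierBandit

end

theorem lemma1 {d m n : ℕ} (hd : 0 < d)
    {𝒜 : Set (HierBandit.Vec d)} (h𝒜 : ∀ a ∈ 𝒜, ‖a‖ ≤ 1)
    {sel : HierBandit.Vec d → HierBandit.Vec d} (hsel : HierBandit.IsArgmax 𝒜 sel)
    (μq : HierBandit.Vec d) {Sq S0 : Matrix (Fin d) (Fin d) ℝ}
    (hSq : Sq.PosSemidef) (hS0 : S0.PosDef) {σ : ℝ} (hσ : 0 < σ)
    {Ω : Type*} [MeasurableSpace Ω] (P : Measure Ω) [IsProbabilityMeasure P]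
    (X : HierBandit.Interaction Ω d m) (hX : X.IsHierTS sel P μq Sq S0 σ n)
    {δ : ℝ} (hδ : 0 < δ) :
    Integrable (X.regret sel) P ∧ Integrable (X.sumPostVar sel P) P ∧
    X.bayesRegret sel P ≤
      Real.sqrt (2 * d * m * n * X.expPostVar sel P * Real.log (1 / δ)) +
        Real.sqrt (2 / Real.pi) * HierBandit.sigmaMax S0 Sq * (d : ℝ) ^ (3 / 2 : ℝ) * m * n * δ ∧
    (𝒜.Finite → X.bayesRegret sel P ≤
      Real.sqrt (2 * m * n * X.expPostVar sel P * Real.log (1 / δ)) +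
        Real.sqrt (2 / Real.pi) * HierBandit.sigmaMax S0 Sq * (𝒜.ncard : ℝ) * m * n * δ) := by
  have h1 : ∀ θ, ‖sel θ‖ ≤ 1 := fun θ => h𝒜 _ (hsel.mem θ)
  obtain ⟨hR, hV, hmain⟩ := hX.bayesRegret_le hsel h1 hσ hd hSq hS0
  have hs : 0 ≤ HierBandit.sigmaMax S0 Sq := Real.sqrt_nonneg _
  -- the threshold is `c = √(2 ℓ)`; for `δ > 1` the bound for `δ = 1`, where `ℓ = 0`, suffices
  set ℓ : ℝ := max (Real.log (1 / δ)) 0 with hℓ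
  have hℓ0 : 0 ≤ ℓ := le_max_right _ _
  have hexp : Real.exp (-√(2 * ℓ) ^ 2 / 2) ≤ δ := by
    rw [Real.sq_sqrt (by positivity), show -(2 * ℓ) / 2 = -ℓ by ring]
    refine (Real.exp_le_exp.2 (neg_le_neg (le_max_left _ _))).trans_eq ?_
    rw [one_div, Real.log_inv, neg_neg, Real.exp_log hδ]
  have hsqrt : ∀ x : ℝ, √(2 * ℓ) * √x ≤ √(2 * x * Real.log (1 / δ)) := fun x => by
    rcases le_total (Real.log (1 / δ)) 0 with h | h
    · rw [hℓ, max_eq_right h, mul_zero, Real.sqrt_zero, zero_mul]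
      exact Real.sqrt_nonneg _
    · rw [hℓ, max_eq_left h, ← Real.sqrt_mul (by positivity)]
      exact Real.sqrt_le_sqrt (by ring_nf; rfl)
  have hfactor : ∀ k : ℝ, 0 ≤ k → k * (√(2 / Real.pi) * Real.exp (-√(2 * ℓ) ^ 2 / 2)) * (m * n) ≤
      √(2 / Real.pi) * k * m * n * δ := fun k hk => by
    calc k * (√(2 / Real.pi) * Real.exp (-√(2 * ℓ) ^ 2 / 2)) * (m * n)
        ≤ k * (√(2 / Real.pi) * δ) * (m * n) := by gcongr
      _ = _ := by ring
  refine ⟨hR, hV, ?_, fun hfin => ?_⟩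
  · refine (hmain (√d * √(2 * ℓ)) _ (by positivity) (by positivity) fun π hπ hVπ =>
      HierBandit.integral_inner_sel_sub_mean_le hsel.measurable h1 hs hVπ
        (Real.sqrt_nonneg _)).trans ?_
    refine add_le_add ?_ ?_
    · calc √d * √(2 * ℓ) * √(m * n * X.expPostVar sel P)
          = √(2 * ℓ) * √(d * (m * n * X.expPostVar sel P)) := by
            rw [Real.sqrt_mul (Nat.cast_nonneg d)]; ring
        _ ≤ _ := (hsqrt _).trans_eq (by ring_nf)
    · have h32 : (d : ℝ) ^ (3 / 2 : ℝ) = √d * d := by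
        rw [show (3 / 2 : ℝ) = 1 / 2 + 1 by norm_num, Real.rpow_add (by positivity),
          Real.rpow_one, ← Real.sqrt_eq_rpow]
      refine (hfactor (√d * d * HierBandit.sigmaMax S0 Sq) (by positivity)).trans_eq ?_
      rw [h32]; ring
  · refine (hmain √(2 * ℓ) _ (by positivity) (by positivity) fun π hπ hVπ =>
      HierBandit.integral_inner_sel_sub_mean_le_of_finite hfin hsel.mem hsel.measurable h𝒜 hs hVπ
        (Real.sqrt_nonneg _)).trans ?_
    refine add_le_add ((hsqrt _).trans_eq (by ring_nf)) ?_
    refine (hfactor (𝒜.ncard * HierBandit.sigmaMax S0 Sq) (by positivity)).trans_eq (by ring)
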